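/- Let $a,b,c,k>0$, $p>q>\tfrac32$, and let $m\in(2,\tfrac{8}{5-p})$ if $p<5$, $m\in(2,\infty)$ if $p\ge 5$. Let $\Omega\subset\mathbb R^2$ be a bounded domain with $C^\infty$ boundary and outward unit normal $\nu$, which is convex in two orthogonal directions and star-shaped with respect to a point $x_0\in\Omega$ with $$\rho_0:=\min_{x\in\partial\Omega}(x-x_0)\cdot\nu(x)>0,\qquad d:=\max_{x\in\overline\Omega}|x-x_0| .$$ Let $g$ be continuous on $[0,\infty)$ with $0\le g(\xi)\le k\,\xi^{\beta}$ for $\xi\ge0$, where $\beta=\frac{m(p-1)}4-m+2$ (which is positive). Let $u_0\in C^{2+\alpha}(\Omega)\cap C^1(\overline\Omega)$, for some $0<\alpha<1$, be positive with $\nabla u_0\cdot\nu=g(u_0)$ on $\partial\Omega$. Let $0<t^*<\infty$ and let $u\in C^{2,1}(\Omega\times(0,t^*))\cap C^{1,0}(\overline\Omega\times[0,t^*))$ be a positive classical solution of $$\begin{cases}u_t=\Delta u^m+a\int_\Omega u^p-b\,u^q-c\,|\nabla\sqrt u|^2 & \text{in }\Omega\times(0,t^*),\\ \nabla u\cdot\nu=g(u)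 & \text{on }\partial\Omega\times[0,t^*),\\ u(x,0)=u_0(x) & x\in\Omega,\end{cases}$$ which blows up in $L^{m(p-1)}(\Omega)$ at time $t^*$, that is, $\lim_{t\to t^*}\int_\Omega u(x,t)^{m(p-1)}\,dx=\infty$. Then there are constants $\bar c_1>0$ and $\bar c_5>0$, depending only on $a,b,c,k,m,p,q,|\Omega|,\rho_0,d$, such that, with $\varphi(0)=\int_\Omega u_0^{m(p-1)}\,dx>0$, $$t^*\ \ge\ T:=\frac1{\bar c_1}\log\Big(1+\frac{\bar c_1}{\bar c_5}\,\varphi(0)^{-1}\Big).$$ In particular $[0,t^*)\supseteq[0,T)$. -/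

import Mathlib

open Set Filter Topology MeasureTheory
open scoped NNReal ContDiff

/-- Euclidean space `ℝᴺ`. -/
abbrev Euc (N : ℕ) : Type := EuclideanSpace ℝ (Fin N)

/-- `r` is a smooth local defining function of `Ω` at `z`: near `z` the set `Ω` is `{r < 0}`,
and the gradient of `r` does not vanish at `z`. -/
def IsLocalDefiningFunction {N : ℕ} (Ω : Set (Euc N)) (z : Euc N) (r : Euc N → ℝ) : Prop :=
  ContDiff ℝ ∞ r ∧ gradient r z ≠ 0 ∧ ∀ᶠ y in 𝓝 z, (y ∈ Ω ↔ r y < 0)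

/-- A bounded domain (nonempty connected open set) of class `C^∞`, lying locally on one side
of its boundary. -/
structure IsBoundedSmoothDomain {N : ℕ} (Ω : Set (Euc N)) : Prop where
  isOpen : IsOpen Ω
  isConnected : IsConnected Ω
  isBounded : Bornology.IsBounded Ω
  smooth : ∀ z ∈ frontier Ω, ∃ r : Euc N → ℝ, IsLocalDefiningFunction Ω z r

/-- `ν` is the outward unit normal vector to `Ω` at the boundary point `z`. -/
def IsOutwardUnitNormal {N : ℕ} (Ω : Set (Euc N)) (z ν : Euc N) : Prop :=
  z ∈ frontier Ω ∧ ∃ r : Euc N → ℝ, IsLocalDefiningFunction Ω z r ∧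
    ν = ‖gradient r z‖⁻¹ • gradient r z

/-- `Ω` is convex in the direction `e`: every line parallel to `e` meets `Ω` in a convex set. -/
def ConvexInDirection {N : ℕ} (Ω : Set (Euc N)) (e : Euc N) : Prop :=
  ∀ x ∈ Ω, ∀ s : ℝ, x + s • e ∈ Ω → segment ℝ x (x + s • e) ⊆ Ω

/-- The geometric assumption on the domain: `Ω` is a bounded smooth domain, star-shaped with
respect to the interior point `x₀`, convex in two orthogonal directions,
`ρ₀ = min_{∂Ω} (x - x₀) · ν > 0` and `d = max_{closure Ω} |x - x₀|`. -/
structure GeometricAssumption {N : ℕ} (Ω : Set (Euc N)) (x₀ : Euc N) (ρ₀ d : ℝ) : Prop where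
  domain : IsBoundedSmoothDomain Ω
  mem : x₀ ∈ Ω
  starShaped : StarConvex ℝ x₀ Ω
  convexDirections : ∃ e₁ e₂ : Euc N, e₁ ≠ 0 ∧ e₂ ≠ 0 ∧ inner ℝ e₁ e₂ = 0 ∧
    ConvexInDirection Ω e₁ ∧ ConvexInDirection Ω e₂
  rho_pos : 0 < ρ₀
  rho_min : IsLeast {s : ℝ | ∃ z ν : Euc N, IsOutwardUnitNormal Ω z ν ∧ s = inner ℝ (z - x₀) ν} ρ₀
  d_max : IsGreatest ((fun x : Euc N => ‖x - x₀‖) '' closure Ω) d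

/-- `v` belongs to `C^{2+α}(Ω)`: it is `C²` in `Ω` and its second derivatives are Hölder continuous
with exponent `α` on every compact subset of `Ω`. -/
def IsC2Holder {N : ℕ} (Ω : Set (Euc N)) (α : ℝ≥0) (v : Euc N → ℝ) : Prop :=
  ContDiffOn ℝ 2 v Ω ∧ ∀ K ⊆ Ω, IsCompact K →
    ∃ C : ℝ≥0, HolderOnWith C α (fun x => iteratedFDeriv ℝ 2 v x) K

/-- `v` belongs to `C¹(closure Ω)`: `v` is continuous on the closure and differentiable in `Ω`, and
`Dv` is the continuous extension of its gradient to the closure. -/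
structure IsC1Closure {N : ℕ} (Ω : Set (Euc N)) (v : Euc N → ℝ) (Dv : Euc N → Euc N) : Prop where
  cont : ContinuousOn v (closure Ω)
  cont_grad : ContinuousOn Dv (closure Ω)
  hasGradient : ∀ x ∈ Ω, HasGradientAt v (Dv x) x

/-- `u` belongs to `C^{1,0}(closure Ω × [0, T))`, and `Du` is its spatial gradient, extended
continuously up to the boundary of `Ω`. -/
structure IsC10 {N : ℕ} (Ω : Set (Euc N)) (T : ℝ) (u : Euc N → ℝ → ℝ)
    (Du : Euc N → ℝ → Euc N) : Prop where
  cont : ContinuousOn (fun z : Euc N × ℝ => u z.1 z.2) (closure Ω ×ˢ Ico 0 T)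
  cont_grad : ContinuousOn (fun z : Euc N × ℝ => Du z.1 z.2) (closure Ω ×ˢ Ico 0 T)
  hasGradient : ∀ x ∈ Ω, ∀ t ∈ Ico 0 T, HasGradientAt (fun y => u y t) (Du x t) x

/-- `u` belongs to `C^{2,1}(Ω × (0, T))`: `u`, its spatial derivatives up to order two and its time
derivative exist and are jointly continuous in `Ω × (0, T)`. -/
structure IsC21 {N : ℕ} (Ω : Set (Euc N)) (T : ℝ) (u : Euc N → ℝ → ℝ) : Prop where
  cont : ContinuousOn (fun z : Euc N × ℝ => u z.1 z.2) (Ω ×ˢ Ioo 0 T)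
  contDiff_space : ∀ t ∈ Ioo 0 T, ContDiffOn ℝ 2 (fun y => u y t) Ω
  cont_fderiv : ContinuousOn (fun z : Euc N × ℝ => fderiv ℝ (fun y => u y z.2) z.1) (Ω ×ˢ Ioo 0 T)
  cont_second : ContinuousOn
    (fun z : Euc N × ℝ => iteratedFDeriv ℝ 2 (fun y => u y z.2) z.1) (Ω ×ˢ Ioo 0 T)
  diff_time : ∀ x ∈ Ω, ∀ t ∈ Ioo 0 T, DifferentiableAt ℝ (fun τ => u x τ) t
  cont_time : ContinuousOn (fun z : Euc N × ℝ => deriv (fun τ => u z.1 τ) z.2) (Ω ×ˢ Ioo 0 T)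

/-- `u` is a positive classical solution on `[0, T)` of
`u_t = Δ u^m + a ∫_Ω u^p - b u^q - c |∇ √u|²` in `Ω × (0, T)`,
`∇u · ν = g(u)` on `∂Ω × [0, T)`, and `u(x, 0) = u₀(x)` for `x ∈ Ω`. -/
structure IsClassicalSolution {N : ℕ} (Ω : Set (Euc N)) (a b c m p q : ℝ) (g : ℝ → ℝ)
    (u₀ : Euc N → ℝ) (T : ℝ) (u : Euc N → ℝ → ℝ) : Prop where
  time_pos : 0 < T
  pos : ∀ x ∈ closure Ω, ∀ t ∈ Ico 0 T, 0 < u x t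
  regular : IsC21 Ω T u
  pde : ∀ x ∈ Ω, ∀ t ∈ Ioo 0 T,
    deriv (fun τ => u x τ) t =
      Laplacian.laplacian (fun y => u y t ^ m) x + a * (∫ y in Ω, u y t ^ p)
        - b * u x t ^ q - c * ‖gradient (fun y => √(u y t)) x‖ ^ 2
  boundary : ∃ Du : Euc N → ℝ → Euc N, IsC10 Ω T u Du ∧
    ∀ t ∈ Ico 0 T, ∀ z ν : Euc N, IsOutwardUnitNormal Ω z ν → inner ℝ (Du z t) ν = g (u z t)
  initial : ∀ x ∈ Ω, u x 0 = u₀ x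

/-- `V` blows up in the `L^{m(p-1)}(Ω)` norm at the finite time `T`. -/
def BlowsUpAt {N : ℕ} (Ω : Set (Euc N)) (m p : ℝ) (V : Euc N → ℝ → ℝ) (T : ℝ) : Prop :=
  Tendsto (fun t => ∫ x in Ω, V x t ^ (m * (p - 1))) (𝓝[<] T) atTop

/-! Put `s = m * (p - 1)` and φ(t) = ∫ u^s. The claim follows from φ' ≤ c₁φ + c₅φ², because Φ(y) =
(1/c₁) log(1 + c₁/(c₅ y)) is a primitive of -1/(c₁y + c₅y²) that vanishes at infinity: Φ(φ(t)) + t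
is nondecreasing in effect and tends to t* at blow-up (`le_blowup_time_of_integral_le`). To obtain
the inequality, test the equation with u^(s-1). The square produced by diffusion and the term -b u^q
have a good sign and are dropped. The boundary term is m ∫_∂Ω u^(s+m-2) g(u), and the growth of g is
chosen so that the exponents add up to 5s/4. Since (x - x₀)·ν ≥ ρ₀ on ∂Ω, the divergence theorem for
u^(5s/4) (x - x₀) bounds it by interior integrals of u^(5s/4) and u^(5s/4-1)|∇u|. The nonlocal term
has total exponent p + s - 1, which lies between s and 3s/2. So everything reduces to φ, X = ∫
u^(3s/2) and D = ∫ u^(s-2)|∇u|². The damping term c|∇√u|² supplies -(c/4)D, and the planar Sobolev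
inequality gives ∫ u^(2s) ≤ Kφ(φ + D), which controls X by a small multiple of D plus multiples of φ
and φ² (`exists_energy_constants`). No surface integral is ever formed. The domain is written as {r
< 0} with r smooth and ∇r ≠ 0 on ∂Ω (`GeometricAssumption.exists_definingFunction`), and integrals
carry a cutoff that is a function of r. Its gradient is a nonpositive multiple of ∇r concentrated in
a thin layer, so it plays the part of -ν times surface measure: boundary inequalities become
inequalities in the layer, and the identity for (x - x₀) turns layer integrals back into interior
ones. The time inequality is proved in integrated form (`IsClassicalSolution.setIntegral_sub_le`),
after letting the layer width, and then the slack δ, tend to zero. -/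

/-! ### Star-shaped geometry and a global defining function. -/

theorem IsLocalDefiningFunction.isOutwardUnitNormal {N : ℕ} {Ω : Set (Euc N)} {z : Euc N}
    {r : Euc N → ℝ} (hr : IsLocalDefiningFunction Ω z r) (hz : z ∈ frontier Ω) :
    IsOutwardUnitNormal Ω z (‖gradient r z‖⁻¹ • gradient r z) :=
  ⟨hz, r, hr, rfl⟩

/-- In a star-shaped domain the radial direction makes a positive angle with the gradient of a
local defining function. -/
theorem GeometricAssumption.rho_mul_norm_gradient_le {N : ℕ} {Ω : Set (Euc N)} {x₀ : Euc N}
    {ρ₀ d : ℝ} (h : GeometricAssumption Ω x₀ ρ₀ d) {z : Euc N} {r : Euc N → ℝ}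
    (hr : IsLocalDefiningFunction Ω z r) (hz : z ∈ frontier Ω) :
    ρ₀ * ‖gradient r z‖ ≤ inner ℝ (z - x₀) (gradient r z) := by
  have h1 := h.rho_min.2 ⟨z, _, hr.isOutwardUnitNormal hz, rfl⟩
  rw [inner_smul_right] at h1
  have h2 : 0 < ‖gradient r z‖ := norm_pos_iff.2 hr.2.1
  have h3 := mul_le_mul_of_nonneg_right h1 h2.le
  rwa [mul_right_comm, inv_mul_cancel₀ h2.ne', one_mul] at h3

theorem ContDiff.continuous_gradient {N : ℕ} {r : Euc N → ℝ} {n : WithTop ℕ∞}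
    (hr : ContDiff ℝ n r) (hn : n ≠ 0) : Continuous (gradient r) :=
  (InnerProductSpace.toDual ℝ (Euc N)).symm.continuous.comp (hr.continuous_fderiv hn)

/-- These are the patches to be glued. Positivity of the radial derivative survives convex
combinations, whereas mere nonvanishing of the gradient would not. At an interior point the constant
-1 serves, on a ball that misses the boundary. -/
theorem GeometricAssumption.exists_local {N : ℕ} {Ω : Set (Euc N)} {x₀ : Euc N}
    {ρ₀ d : ℝ} (h : GeometricAssumption Ω x₀ ρ₀ d) {x : Euc N} (hx : x ∈ closure Ω) :
    ∃ (r : Euc N → ℝ) (δ : ℝ), 0 < δ ∧ ContDiff ℝ ∞ r ∧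
      (∀ y ∈ Metric.ball x δ, (y ∈ Ω ↔ r y < 0)) ∧
      ∀ z ∈ frontier Ω, z ∈ Metric.ball x δ → 0 < fderiv ℝ r z (z - x₀) := by
  have hfr : frontier Ω = closure Ω \ Ω := h.domain.isOpen.frontier_eq
  by_cases hxΩ : x ∈ Ω
  · obtain ⟨δ, hδ, hb⟩ := Metric.isOpen_iff.1 h.domain.isOpen x hxΩ
    refine ⟨fun _ => -1, δ, hδ, contDiff_const, fun y hy => ?_, fun z hz hzb => ?_⟩
    · simp [hb hy]
    · rw [hfr] at hz
      exact absurd (hb hzb) hz.2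
  · obtain ⟨r, hr, hg, he⟩ := h.domain.smooth x (by rw [hfr]; exact ⟨hx, hxΩ⟩)
    have h1 : ∀ᶠ y in 𝓝 x, gradient r y ≠ 0 :=
      (hr.continuous_gradient (by simp)).continuousAt.eventually_ne hg
    obtain ⟨δ, hδ, hb⟩ := Metric.eventually_nhds_iff_ball.1 (h1.and he.eventually_nhds)
    refine ⟨r, δ, hδ, hr, fun y hy => (hb y hy).2.self_of_nhds, fun z hz hzb => ?_⟩
    have hloc : IsLocalDefiningFunction Ω z r := ⟨hr, (hb z hzb).1, (hb z hzb).2⟩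
    have h2 := h.rho_mul_norm_gradient_le hloc hz
    have h3 : 0 < ρ₀ * ‖gradient r z‖ := mul_pos h.rho_pos (norm_pos_iff.2 hloc.2.1)
    rw [real_inner_comm, inner_gradient_left] at h2
    linarith

theorem GeometricAssumption.isCompact_closure {N : ℕ} {Ω : Set (Euc N)} {x₀ : Euc N}
    {ρ₀ d : ℝ} (h : GeometricAssumption Ω x₀ ρ₀ d) : IsCompact (closure Ω) :=
  h.domain.isBounded.isCompact_closure

/-- A bounded smooth star-shaped domain is a strict sublevel set of a global smooth function whose
gradient does not vanish on the boundary. -/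
theorem GeometricAssumption.exists_definingFunction {N : ℕ} {Ω : Set (Euc N)} {x₀ : Euc N}
    {ρ₀ d : ℝ} (h : GeometricAssumption Ω x₀ ρ₀ d) :
    ∃ r : Euc N → ℝ, ContDiff ℝ ∞ r ∧ (∀ y, y ∈ Ω ↔ r y < 0) ∧
      ∀ z ∈ frontier Ω, IsLocalDefiningFunction Ω z r := by
  classical
  have hfr : frontier Ω = closure Ω \ Ω := h.domain.isOpen.frontier_eq
  choose! R δ hδ hR hiff hpos using fun x (hx : x ∈ closure Ω) => h.exists_local hx
  -- The bump is 1 on the quarter ball, used for the covering, and its closed support lies inside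
  -- the ball of radius `δ x`, so both it and its derivative vanish outside that ball. The case
  -- split is needed because `δ x` is known to be positive only on the closure.
  let f : ∀ x : Euc N, Euc N → ℝ := fun x =>
    if hx : 0 < δ x then
      (⟨δ x / 4, δ x / 2, by linarith, by linarith⟩ : ContDiffBump x) else 0
  have hf : ∀ x (hx : 0 < δ x), f x =
      (⟨δ x / 4, δ x / 2, by linarith, by linarith⟩ : ContDiffBump x) := fun x hx => dif_pos hx
  obtain ⟨t, htΩ, hcov⟩ := h.isCompact_closure.elim_nhds_subcover
    (fun x => Metric.ball x (δ x / 4)) (fun x hx => Metric.ball_mem_nhds _ (by linarith [hδ x hx]))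
  have hfs : ∀ x ∈ closure Ω, ContDiff ℝ ∞ (f x) := fun x hx => by
    rw [hf x (hδ x hx)]; exact ContDiffBump.contDiff _
  have hf0 : ∀ x ∈ closure Ω, ∀ y, 0 ≤ f x y := fun x hx y => by
    rw [hf x (hδ x hx)]; exact ContDiffBump.nonneg _
  have hfball : ∀ x ∈ closure Ω, ∀ y, f x y ≠ 0 → y ∈ Metric.ball x (δ x) := fun x hx y hy => by
    rw [hf x (hδ x hx)] at hy
    have := (ContDiffBump.support_eq _).subset (show y ∈ Function.support _ from hy)
    exact Metric.ball_subset_ball (by linarith [hδ x hx]) this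
  have hfD : ∀ x ∈ closure Ω, ∀ y, y ∉ Metric.ball x (δ x) → fderiv ℝ (f x) y = 0 := by
    intro x hx y hy
    refine fderiv_of_notMem_tsupport ℝ fun hy' => hy ?_
    rw [hf x (hδ x hx), ContDiffBump.tsupport_eq] at hy'
    exact Metric.closedBall_subset_ball (by simpa using hδ x hx) hy'
  have hf1 : ∀ x ∈ closure Ω, ∀ y ∈ Metric.ball x (δ x / 4), f x y = 1 := fun x hx y hy => by
    rw [hf x (hδ x hx)]
    exact ContDiffBump.one_of_mem_closedBall _ (Metric.ball_subset_closedBall hy)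
  have hiff' : ∀ y, y ∈ Ω ↔ ∑ x ∈ t, f x y * R x y < 0 := by
    intro y
    constructor
    · intro hy
      have hterm : ∀ x ∈ t, f x y * R x y ≤ 0 := fun x hx => by
        by_cases h0 : f x y = 0
        · simp [h0]
        · exact mul_nonpos_of_nonneg_of_nonpos (hf0 x (htΩ x hx) y)
            (((hiff x (htΩ x hx) y (hfball x (htΩ x hx) y h0)).1 hy).le)
      obtain ⟨x, hx, hyx⟩ := mem_iUnion₂.1 (hcov (subset_closure hy))
      have h1 := hf1 x (htΩ x hx) y hyx
      refine Finset.sum_neg' hterm ⟨x, hx, ?_⟩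
      rw [h1, one_mul]
      exact (hiff x (htΩ x hx) y (hfball x (htΩ x hx) y (by rw [h1]; exact one_ne_zero))).1 hy
    · intro hy
      by_contra hyΩ
      refine absurd hy (not_lt.2 (Finset.sum_nonneg fun x hx => ?_))
      by_cases h0 : f x y = 0
      · simp [h0]
      · refine mul_nonneg (hf0 x (htΩ x hx) y) (not_lt.1 fun hneg => hyΩ ?_)
        exact (hiff x (htΩ x hx) y (hfball x (htΩ x hx) y h0)).2 hneg
  have hsm : ContDiff ℝ ∞ fun y => ∑ x ∈ t, f x y * R x y :=
    ContDiff.sum fun x hx => (hfs x (htΩ x hx)).mul (hR x (htΩ x hx))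
  refine ⟨_, hsm, hiff', fun z hz => ⟨hsm, fun hg => ?_, Eventually.of_forall hiff'⟩⟩
  have hzc : z ∈ closure Ω := frontier_subset_closure hz
  have hzΩ : z ∉ Ω := by rw [hfr] at hz; exact hz.2
  have hder : HasFDerivAt (fun y => ∑ x ∈ t, f x y * R x y)
      (∑ x ∈ t, (f x z • fderiv ℝ (R x) z + R x z • fderiv ℝ (f x) z)) z := by
    refine HasFDerivAt.fun_sum fun x hx => ?_
    exact (((hfs x (htΩ x hx)).differentiable (by simp)) z).hasFDerivAt.mul
      (((hR x (htΩ x hx)).differentiable (by simp)) z).hasFDerivAt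
  -- A positive value would persist near `z`, contradicting that `Ω` accumulates there; a negative
  -- one would put `z` in `Ω`. Hence the terms containing derivatives of the bumps disappear at
  -- boundary points.
  have hR0 : ∀ x ∈ t, z ∈ Metric.ball x (δ x) → R x z = 0 := by
    intro x hx hzb
    refine le_antisymm (not_lt.1 fun hp => ?_) (not_lt.1 fun hneg => hzΩ ?_)
    · have e1 : ∀ᶠ y in 𝓝 z, 0 < R x y :=
        (hR x (htΩ x hx)).continuous.continuousAt.eventually (lt_mem_nhds hp)
      have e2 := (mem_closure_iff_frequently.1 hzc).and_eventually
        (e1.and (Metric.isOpen_ball.mem_nhds hzb))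
      obtain ⟨y, hy, hy1, hy2⟩ := e2.exists
      exact absurd ((hiff x (htΩ x hx) y hy2).1 hy) (not_lt.2 hy1.le)
    · exact (hiff x (htΩ x hx) z hzb).2 hneg
  have hval : ∀ x ∈ t, (f x z • fderiv ℝ (R x) z + R x z • fderiv ℝ (f x) z) (z - x₀) =
      f x z * fderiv ℝ (R x) z (z - x₀) := by
    intro x hx
    by_cases hzb : z ∈ Metric.ball x (δ x)
    · simp [hR0 x hx hzb]
    · simp [hfD x (htΩ x hx) z hzb]
  have hzero : fderiv ℝ (fun y => ∑ x ∈ t, f x y * R x y) z (z - x₀) = 0 := by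
    rw [← inner_gradient_left, hg, inner_zero_left]
  rw [hder.fderiv, sum_apply, Finset.sum_congr rfl hval] at hzero
  obtain ⟨x, hx, hzx⟩ := mem_iUnion₂.1 (hcov hzc)
  have h1 := hf1 x (htΩ x hx) z hzx
  have hlt : 0 < ∑ x ∈ t, f x z * fderiv ℝ (R x) z (z - x₀) := by
    refine Finset.sum_pos' (fun y hy => ?_) ⟨x, hx, ?_⟩
    · by_cases h0 : f y z = 0
      · simp [h0]
      · exact mul_nonneg (hf0 y (htΩ y hy) z)
          (hpos y (htΩ y hy) z hz (hfball y (htΩ y hy) z h0)).le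
    · rw [h1, one_mul]
      exact hpos x (htΩ x hx) z hz (hfball x (htΩ x hx) z (by rw [h1]; exact one_ne_zero))
  linarith

/-! ### Interior cutoffs built from the defining function. -/

/-- A smooth function that vanishes where `-ε ≤ r` and equals `1` where `r ≤ -2ε`. -/
noncomputable def sublevelCutoff {N : ℕ} (r : Euc N → ℝ) (ε : ℝ) (x : Euc N) : ℝ :=
  Real.smoothTransition (-r x / ε - 1)

section Cutoff

variable {N : ℕ} {Ω : Set (Euc N)} {r : Euc N → ℝ} {ε : ℝ}

theorem sublevelCutoff_nonneg (x : Euc N) : 0 ≤ sublevelCutoff r ε x :=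
  Real.smoothTransition.nonneg _

theorem sublevelCutoff_le_one (x : Euc N) : sublevelCutoff r ε x ≤ 1 :=
  Real.smoothTransition.le_one _

theorem contDiff_sublevelCutoff (hr : ContDiff ℝ ∞ r) : ContDiff ℝ ∞ (sublevelCutoff r ε) :=
  Real.smoothTransition.contDiff.comp ((hr.neg.div_const ε).sub contDiff_const)

theorem tsupport_sublevelCutoff_subset (hr : ContDiff ℝ ∞ r) (hε : 0 < ε) :
    tsupport (sublevelCutoff r ε) ⊆ {x | r x ≤ -ε} := by
  refine closure_minimal (fun x hx => ?_) (isClosed_le hr.continuous continuous_const)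
  by_contra hlt
  refine hx (Real.smoothTransition.zero_of_nonpos ?_)
  have h1 : -ε < r x := not_le.1 hlt
  rw [sub_nonpos, div_le_one hε]
  linarith

theorem tsupport_sublevelCutoff_subset_domain (hr : ContDiff ℝ ∞ r)
    (hΩ : ∀ y, y ∈ Ω ↔ r y < 0) (hε : 0 < ε) : tsupport (sublevelCutoff r ε) ⊆ Ω := fun x hx =>
  (hΩ x).2 (lt_of_le_of_lt (tsupport_sublevelCutoff_subset hr hε hx) (by linarith))

theorem hasCompactSupport_sublevelCutoff (hr : ContDiff ℝ ∞ r)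
    (hΩ : ∀ y, y ∈ Ω ↔ r y < 0) (hb : Bornology.IsBounded Ω) (hε : 0 < ε) :
    HasCompactSupport (sublevelCutoff r ε) :=
  Metric.isCompact_of_isClosed_isBounded (isClosed_tsupport _)
    (hb.subset (tsupport_sublevelCutoff_subset_domain hr hΩ hε))

/-- The gradient of the cutoff is a nonpositive multiple of the gradient of `r`, and vanishes
outside a thin layer near the boundary. -/
theorem exists_fderiv_sublevelCutoff (hr : ContDiff ℝ ∞ r) (hΩ : ∀ y, y ∈ Ω ↔ r y < 0)
    (hε : 0 < ε) :
    ∃ h : Euc N → ℝ, (∀ x, 0 ≤ h x) ∧ (∀ x, h x ≠ 0 → x ∈ Ω ∧ -(2 * ε) ≤ r x) ∧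
      ∀ x, fderiv ℝ (sublevelCutoff r ε) x = -(h x) • fderiv ℝ r x := by
  refine ⟨fun x => deriv Real.smoothTransition (-r x / ε - 1) / ε, fun x =>
    div_nonneg (Real.smoothTransition.monotone.deriv_nonneg) hε.le, fun x hx => ?_, fun x => ?_⟩
  · have hd : deriv Real.smoothTransition (-r x / ε - 1) ≠ 0 := fun h0 => hx (by simp [h0])
    constructor
    · by_contra hxΩ
      have h1 : 0 ≤ r x := not_lt.1 fun h => hxΩ ((hΩ x).2 h)
      refine hd ?_
      have h2 : -r x / ε - 1 < 0 := by
        have : -r x / ε ≤ 0 := div_nonpos_of_nonpos_of_nonneg (by linarith) hε.le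
        linarith
      have h3 : Real.smoothTransition =ᶠ[𝓝 (-r x / ε - 1)] fun _ => 0 := by
        filter_upwards [gt_mem_nhds h2] with y hy
        exact Real.smoothTransition.zero_of_nonpos (le_of_lt hy)
      rw [h3.deriv_eq, deriv_const]
    · by_contra hlt
      refine hd ?_
      have h2 : 1 < -r x / ε - 1 := by
        have : 2 < -r x / ε := by rw [lt_div_iff₀ hε]; linarith
        linarith
      have h3 : Real.smoothTransition =ᶠ[𝓝 (-r x / ε - 1)] fun _ => 1 := by
        filter_upwards [lt_mem_nhds h2] with y hy
        exact Real.smoothTransition.one_of_one_le (le_of_lt hy)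
      rw [h3.deriv_eq, deriv_const]
  · have h1 : HasDerivAt Real.smoothTransition (deriv Real.smoothTransition (-r x / ε - 1))
        (-r x / ε - 1) :=
      ((Real.smoothTransition.contDiff (n := 1)).differentiable (by simp) _).hasDerivAt
    have h2 : HasFDerivAt (fun y => ε⁻¹ * -r y - 1) (ε⁻¹ • -fderiv ℝ r x) x :=
      (((hr.differentiable (by simp) x).hasFDerivAt.neg).const_mul ε⁻¹).sub_const 1
    have h2' : HasFDerivAt (fun y => -r y / ε - 1) (ε⁻¹ • -fderiv ℝ r x) x := by
      convert h2 using 3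
      rw [div_eq_inv_mul]
    have h3 := (h1.comp_hasFDerivAt x h2').fderiv
    change fderiv ℝ (Real.smoothTransition ∘ fun y => -r y / ε - 1) x = _
    rw [h3, smul_smul, smul_neg, neg_smul, ← div_eq_mul_inv]

/-- Every error made by inserting or removing the cutoff is a fixed multiple of this integral, so
this limit is what finally eliminates it. -/
theorem tendsto_setIntegral_one_sub_sublevelCutoff (hr : ContDiff ℝ ∞ r)
    (hΩ : ∀ y, y ∈ Ω ↔ r y < 0) (hb : Bornology.IsBounded Ω) :
    Tendsto (fun ε => ∫ x in Ω, (1 - sublevelCutoff r ε x)) (𝓝[>] 0) (𝓝 0) := by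
  have hm : MeasurableSet Ω := by
    have : Ω = r ⁻¹' Iio 0 := by ext y; exact hΩ y
    rw [this]; exact (isOpen_Iio.preimage hr.continuous).measurableSet
  have hfin : volume Ω ≠ ⊤ := hb.measure_lt_top.ne
  have h0 : ∫ x in Ω, (0 : ℝ) = 0 := by simp
  suffices H : Tendsto (fun ε => ∫ x in Ω, (1 - sublevelCutoff r ε x)) (𝓝[>] 0)
      (𝓝 (∫ x in Ω, (0 : ℝ))) by rwa [h0] at H
  refine tendsto_integral_filter_of_dominated_convergence (fun _ => 1) ?_ ?_ ?_ ?_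
  · exact Eventually.of_forall fun ε =>
      (continuous_const.sub (contDiff_sublevelCutoff hr).continuous).aestronglyMeasurable
  · refine Eventually.of_forall fun ε => ae_of_all _ fun x => ?_
    rw [Real.norm_eq_abs, abs_le]
    constructor <;> linarith [sublevelCutoff_nonneg (r := r) (ε := ε) x,
      sublevelCutoff_le_one (r := r) (ε := ε) x]
  · exact integrableOn_const hfin
  · refine (ae_restrict_iff' hm).2 (ae_of_all _ fun x hx => ?_)
    have hrx : r x < 0 := (hΩ x).1 hx
    refine tendsto_const_nhds.congr' ?_
    have : ∀ᶠ ε : ℝ in 𝓝[>] 0, ε < -r x / 2 :=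
      mem_nhdsWithin_of_mem_nhds (gt_mem_nhds (by linarith))
    filter_upwards [this, self_mem_nhdsWithin] with ε h1 h2
    have h2' : 0 < ε := h2
    rw [sublevelCutoff, Real.smoothTransition.one_of_one_le, sub_self]
    have : 2 ≤ -r x / ε := by rw [le_div_iff₀ h2']; linarith
    linarith

end Cutoff

/-! ### Integration by parts without boundary terms. -/

section Divergence

variable {N : ℕ} {Ω : Set (Euc N)}

theorem integrable_mul_of_tsupport_subset {q g : Euc N → ℝ} (hq : Continuous q)
    (hc : HasCompactSupport q) (hs : tsupport q ⊆ Ω) (hΩ : IsOpen Ω) (hg : ContinuousOn g Ω) :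
    Integrable fun x => q x * g x := by
  refine Continuous.integrable_of_hasCompactSupport ?_ hc.mul_right
  refine continuous_of_tsupport fun x hx => ?_
  have hxΩ : x ∈ Ω := hs (tsupport_mul_subset_left hx)
  exact hq.continuousAt.mul (hg.continuousAt (hΩ.mem_nhds hxΩ))

theorem setIntegral_eq_integral_of_tsupport_subset {q g : Euc N → ℝ} (hs : tsupport q ⊆ Ω) :
    ∫ x in Ω, q x * g x = ∫ x, q x * g x :=
  setIntegral_eq_integral_of_forall_compl_eq_zero fun x hx => by
    rw [image_eq_zero_of_notMem_tsupport fun h => hx (hs h), zero_mul]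

/-- Integration by parts against a compactly supported function. -/
theorem setIntegral_mul_fderiv_eq_neg {q g : Euc N → ℝ} (hq : ContDiff ℝ 1 q)
    (hc : HasCompactSupport q) (hs : tsupport q ⊆ Ω) (hΩ : IsOpen Ω) (hg : ContDiffOn ℝ 1 g Ω)
    (e : Euc N) :
    ∫ x in Ω, q x * fderiv ℝ g x e = -∫ x in Ω, fderiv ℝ q x e * g x := by
  have hs' := (tsupport_fderiv_apply_subset ℝ (f := q) e).trans hs
  have hc' : HasCompactSupport fun x => fderiv ℝ q x e := hc.fderiv_apply ℝ e
  have hcq : Continuous fun x => fderiv ℝ q x e :=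
    (hq.continuous_fderiv (by simp)).clm_apply continuous_const
  have hgc := hg.continuousOn
  have hg' : ContinuousOn (fun x => fderiv ℝ g x e) Ω :=
    (hg.continuousOn_fderiv_of_isOpen hΩ (by simp)).clm_apply continuousOn_const
  rw [setIntegral_eq_integral_of_tsupport_subset hs, setIntegral_eq_integral_of_tsupport_subset hs']
  exact integral_mul_fderiv_eq_neg_fderiv_mul_of_integrable
    (integrable_mul_of_tsupport_subset hcq hc' hs' hΩ hgc)
    (integrable_mul_of_tsupport_subset hq.continuous hc hs hΩ hg')
    (integrable_mul_of_tsupport_subset hq.continuous hc hs hΩ hgc)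
    (fun x _ => hq.differentiable (by simp) x)
    (fun x hx => (hg.differentiableOn (by simp)).differentiableAt (hΩ.mem_nhds (hs hx)))

theorem sum_apply_basisFun_mul (L : Euc N →L[ℝ] ℝ) (v : Euc N) :
    ∑ i, L (EuclideanSpace.basisFun (Fin N) ℝ i) * v i = L v := by
  conv_rhs => rw [← (EuclideanSpace.basisFun (Fin N) ℝ).sum_repr v]
  rw [map_sum]
  refine Finset.sum_congr rfl fun i _ => ?_
  rw [map_smul, smul_eq_mul, mul_comm, EuclideanSpace.basisFun_repr]

theorem sum_fderiv_mul_fderiv_basisFun {f g : Euc N → ℝ} {x : Euc N} :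
    ∑ i, fderiv ℝ f x (EuclideanSpace.basisFun (Fin N) ℝ i) *
      fderiv ℝ g x (EuclideanSpace.basisFun (Fin N) ℝ i) =
      inner ℝ (gradient f x) (gradient g x) := by
  rw [← (EuclideanSpace.basisFun (Fin N) ℝ).sum_inner_mul_inner]
  simp_rw [← inner_gradient_left]
  refine Finset.sum_congr rfl fun i _ => ?_
  rw [real_inner_comm (gradient g x)]

/-- Divergence theorem for the field `w (x - x₀)` weighted by a cutoff. -/
theorem setIntegral_mul_radial_eq {q w : Euc N → ℝ} (hq : ContDiff ℝ 1 q)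
    (hc : HasCompactSupport q) (hs : tsupport q ⊆ Ω) (hΩ : IsOpen Ω) (hw : ContDiffOn ℝ 1 w Ω)
    (x₀ : Euc N) :
    ∫ x in Ω, q x * (N * w x + fderiv ℝ w x (x - x₀)) =
      -∫ x in Ω, fderiv ℝ q x (x - x₀) * w x := by
  set e := EuclideanSpace.basisFun (Fin N) ℝ with he
  have hcoord : ∀ i, ContDiff ℝ ∞ fun y : Euc N => (y - x₀) i := fun i => by fun_prop
  have hg : ∀ i, ContDiffOn ℝ 1 (fun y : Euc N => w y * (y - x₀) i) Ω := fun i =>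
    hw.mul (((hcoord i).of_le (by simp)).contDiffOn)
  have hg' : ∀ i, ContinuousOn (fun x => fderiv ℝ (fun y : Euc N => w y * (y - x₀) i) x (e i)) Ω :=
    fun i => ((hg i).continuousOn_fderiv_of_isOpen hΩ (by simp)).clm_apply continuousOn_const
  have hcq : ∀ i, Continuous fun x => fderiv ℝ q x (e i) := fun i =>
    (hq.continuous_fderiv (by simp)).clm_apply continuous_const
  -- Summed over `i`, these are the terms of the divergence of w (x - x₀), namely N w + ∇w·(x - x₀).
  have hval : ∀ x ∈ Ω, ∀ i, fderiv ℝ (fun y : Euc N => w y * (y - x₀) i) x (e i) =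
      w x + fderiv ℝ w x (e i) * (x - x₀) i := by
    intro x hx i
    have h1 : HasFDerivAt w (fderiv ℝ w x) x :=
      ((hw.differentiableOn (by simp)).differentiableAt (hΩ.mem_nhds hx)).hasFDerivAt
    have h2 : HasFDerivAt (fun y : Euc N => (y - x₀) i)
        (EuclideanSpace.proj i : Euc N →L[ℝ] ℝ) x :=
      (EuclideanSpace.proj i : Euc N →L[ℝ] ℝ).hasFDerivAt.comp x
        ((hasFDerivAt_id x).sub_const x₀)
    rw [(h1.fun_mul h2).fderiv]
    simp [he, mul_comm]
  have key : ∀ i, ∫ x in Ω, q x * (w x + fderiv ℝ w x (e i) * (x - x₀) i) =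
      -∫ x in Ω, fderiv ℝ q x (e i) * (w x * (x - x₀) i) := by
    intro i
    rw [← setIntegral_mul_fderiv_eq_neg hq hc hs hΩ (hg i) (e i)]
    exact setIntegral_congr_fun hΩ.measurableSet fun x hx => by simp only [hval x hx i]
  calc ∫ x in Ω, q x * (N * w x + fderiv ℝ w x (x - x₀))
      = ∫ x in Ω, ∑ i, q x * (w x + fderiv ℝ w x (e i) * (x - x₀) i) := by
        refine setIntegral_congr_fun hΩ.measurableSet fun x hx => ?_
        simp only
        rw [← Finset.mul_sum, Finset.sum_add_distrib, sum_apply_basisFun_mul]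
        simp
    _ = ∑ i, ∫ x in Ω, q x * (w x + fderiv ℝ w x (e i) * (x - x₀) i) := by
        refine integral_finsetSum _ fun i _ => ?_
        refine ((integrable_mul_of_tsupport_subset hq.continuous hc hs hΩ
          (hg' i)).integrableOn).congr_fun (fun x hx => ?_) hΩ.measurableSet
        simp only [hval x hx i]
    _ = ∑ i, -∫ x in Ω, fderiv ℝ q x (e i) * (w x * (x - x₀) i) :=
        Finset.sum_congr rfl fun i _ => key i
    _ = -∫ x in Ω, ∑ i, fderiv ℝ q x (e i) * (w x * (x - x₀) i) := by
        rw [Finset.sum_neg_distrib, integral_finsetSum]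
        intro i _
        exact (integrable_mul_of_tsupport_subset (hcq i) (hc.fderiv_apply ℝ _)
          ((tsupport_fderiv_apply_subset ℝ (f := q) _).trans hs) hΩ (hg i).continuousOn).integrableOn
    _ = -∫ x in Ω, fderiv ℝ q x (x - x₀) * w x := by
        congr 1
        refine setIntegral_congr_fun hΩ.measurableSet fun x hx => ?_
        simp only
        rw [← sum_apply_basisFun_mul (fderiv ℝ q x) (x - x₀), Finset.sum_mul]
        exact Finset.sum_congr rfl fun i _ => by ring

/-- Green's first identity against a compactly supported function. -/
theorem setIntegral_mul_laplacian_eq {q W : Euc N → ℝ} (hq : ContDiff ℝ 1 q)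
    (hc : HasCompactSupport q) (hs : tsupport q ⊆ Ω) (hΩ : IsOpen Ω) (hW : ContDiffOn ℝ 2 W Ω) :
    ∫ x in Ω, q x * Laplacian.laplacian W x =
      -∫ x in Ω, inner ℝ (gradient q x) (gradient W x) := by
  set e := EuclideanSpace.basisFun (Fin N) ℝ with he
  have hDW : ContDiffOn ℝ 1 (fderiv ℝ W) Ω := by
    have h2 : ContDiffOn ℝ (1 + 1) W Ω := by rw [one_add_one_eq_two]; exact hW
    exact ((contDiffOn_succ_iff_fderiv_of_isOpen hΩ).1 h2).2.2
  have hg : ∀ i, ContDiffOn ℝ 1 (fun y => fderiv ℝ W y (e i)) Ω := fun i =>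
    hDW.clm_apply contDiffOn_const
  have hg' : ∀ i, ContinuousOn (fun x => fderiv ℝ (fun y => fderiv ℝ W y (e i)) x (e i)) Ω :=
    fun i => ((hg i).continuousOn_fderiv_of_isOpen hΩ (by simp)).clm_apply continuousOn_const
  have hcq : ∀ i, Continuous fun x => fderiv ℝ q x (e i) := fun i =>
    (hq.continuous_fderiv (by simp)).clm_apply continuous_const
  calc ∫ x in Ω, q x * Laplacian.laplacian W x
      = ∫ x in Ω, ∑ i, q x * fderiv ℝ (fun y => fderiv ℝ W y (e i)) x (e i) := by
        refine setIntegral_congr_fun hΩ.measurableSet fun x hx => ?_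
        rw [InnerProductSpace.laplacian_eq_iteratedFDeriv_orthonormalBasis W e, Finset.mul_sum]
        refine Finset.sum_congr rfl fun i _ => ?_
        have h1 : HasFDerivAt (fderiv ℝ W) (fderiv ℝ (fderiv ℝ W) x) x :=
          ((hDW.differentiableOn (by simp)).differentiableAt (hΩ.mem_nhds hx)).hasFDerivAt
        rw [iteratedFDeriv_two_apply, (h1.clm_apply (hasFDerivAt_const (e i) x)).fderiv]
        simp
    _ = ∑ i, ∫ x in Ω, q x * fderiv ℝ (fun y => fderiv ℝ W y (e i)) x (e i) :=
        integral_finsetSum _ fun i _ => (integrable_mul_of_tsupport_subset hq.continuous hc hs hΩ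
          (hg' i)).integrableOn
    _ = ∑ i, -∫ x in Ω, fderiv ℝ q x (e i) * fderiv ℝ W x (e i) :=
        Finset.sum_congr rfl fun i _ => setIntegral_mul_fderiv_eq_neg hq hc hs hΩ (hg i) (e i)
    _ = -∫ x in Ω, ∑ i, fderiv ℝ q x (e i) * fderiv ℝ W x (e i) := by
        rw [Finset.sum_neg_distrib, integral_finsetSum]
        intro i _
        exact (integrable_mul_of_tsupport_subset (hcq i) (hc.fderiv_apply ℝ _)
          ((tsupport_fderiv_apply_subset ℝ (f := q) _).trans hs) hΩ (hg i).continuousOn).integrableOn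
    _ = -∫ x in Ω, inner ℝ (gradient q x) (gradient W x) := by
        exact congrArg _ (setIntegral_congr_fun hΩ.measurableSet fun x _ =>
          sum_fderiv_mul_fderiv_basisFun)

end Divergence

/-! ### Passing from boundary inequalities to boundary layers. -/

theorem IsOpen.integrableOn_of_bounded {N : ℕ} {Ω : Set (Euc N)} (hΩ : IsOpen Ω)
    (hb : Bornology.IsBounded Ω) {f : Euc N → ℝ} (hf : ContinuousOn f Ω) {M : ℝ}
    (hM : ∀ x ∈ Ω, |f x| ≤ M) : IntegrableOn f Ω :=
  IntegrableOn.of_bound hb.measure_lt_top (hf.aestronglyMeasurable hΩ.measurableSet) M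
    ((ae_restrict_iff' hΩ.measurableSet).2 (ae_of_all _ hM))

/-- A function positive on the lateral boundary is positive in a boundary layer, uniformly in a
compact parameter. -/
theorem exists_layer_pos {N : ℕ} {Ω : Set (Euc N)} {r : Euc N → ℝ} (hr : Continuous r)
    (hΩ : ∀ y, y ∈ Ω ↔ r y < 0) (hc : IsCompact (closure Ω)) {S : Set ℝ} (hS : IsCompact S)
    {A : Euc N × ℝ → ℝ} (hA : ContinuousOn A (closure Ω ×ˢ S))
    (hpos : ∀ z ∈ frontier Ω, ∀ t ∈ S, 0 < A (z, t)) :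
    ∃ ε > 0, ∀ x ∈ Ω, ∀ t ∈ S, -ε ≤ r x → 0 < A (x, t) := by
  have ho : IsOpen Ω := by
    have : Ω = r ⁻¹' Iio 0 := by ext y; exact hΩ y
    rw [this]; exact isOpen_Iio.preimage hr
  -- The bad set is compact and misses the boundary, so `r` attains a negative maximum on it; half
  -- of that value gives the width of the layer.
  set K := (closure Ω ×ˢ S) ∩ A ⁻¹' Iic 0 with hK
  have hKc : IsCompact K := (hc.prod hS).of_isClosed_subset
    (hA.preimage_isClosed_of_isClosed (hc.prod hS).isClosed isClosed_Iic) inter_subset_left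
  rcases K.eq_empty_or_nonempty with he | hne
  · refine ⟨1, one_pos, fun x hx t ht _ => ?_⟩
    by_contra hle
    have : (x, t) ∈ K := ⟨⟨subset_closure hx, ht⟩, not_lt.1 hle⟩
    rw [he] at this
    exact this
  · obtain ⟨p, hp, hmax⟩ := hKc.exists_isMaxOn hne (hr.comp continuous_fst).continuousOn
    have hpΩ : p.1 ∈ Ω := by
      by_contra hn
      have : p.1 ∈ frontier Ω := by rw [ho.frontier_eq]; exact ⟨hp.1.1, hn⟩
      exact absurd (hpos p.1 this p.2 hp.1.2) (not_lt.2 hp.2)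
    have hrp := (hΩ _).1 hpΩ
    refine ⟨-r p.1 / 2, by linarith, fun x hx t ht hrx => ?_⟩
    by_contra hle
    have hm : (x, t) ∈ K := ⟨⟨subset_closure hx, ht⟩, not_lt.1 hle⟩
    have h2 : r x ≤ r p.1 := hmax hm
    linarith

theorem norm_gradient_eq_norm_fderiv {N : ℕ} (f : Euc N → ℝ) (x : Euc N) :
    ‖gradient f x‖ = ‖fderiv ℝ f x‖ :=
  (InnerProductSpace.toDual ℝ (Euc N)).symm.norm_map _

theorem GeometricAssumption.exists_layer_radial {N : ℕ} {Ω : Set (Euc N)} {x₀ : Euc N} {ρ₀ d : ℝ}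
    (h : GeometricAssumption Ω x₀ ρ₀ d) {r : Euc N → ℝ} (hr : ContDiff ℝ ∞ r)
    (hΩ : ∀ y, y ∈ Ω ↔ r y < 0) (hl : ∀ z ∈ frontier Ω, IsLocalDefiningFunction Ω z r) :
    ∃ ε > 0, ∀ x ∈ Ω, -ε ≤ r x →
      ρ₀ * ‖fderiv ℝ r x‖ ≤ 2 * fderiv ℝ r x (x - x₀) := by
  have hc : Continuous (fderiv ℝ r) := hr.continuous_fderiv (by simp)
  have hA : Continuous fun p : Euc N × ℝ =>
      2 * fderiv ℝ r p.1 (p.1 - x₀) - ρ₀ * ‖fderiv ℝ r p.1‖ := by fun_prop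
  obtain ⟨ε, hε, H⟩ := exists_layer_pos hr.continuous hΩ h.isCompact_closure
    -- The parameter set is a dummy point. The factor 2 in the target makes the boundary inequality
    -- strict, as extension into a layer requires.
    (isCompact_singleton (x := (0 : ℝ))) hA.continuousOn (fun z hz t _ => by
      have h1 := h.rho_mul_norm_gradient_le (hl z hz) hz
      have h2 : 0 < ρ₀ * ‖gradient r z‖ := mul_pos h.rho_pos (norm_pos_iff.2 (hl z hz).2.1)
      rw [real_inner_comm, inner_gradient_left] at h1
      rw [norm_gradient_eq_norm_fderiv] at h1 h2
      simp only
      linarith)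
  exact ⟨ε, hε, fun x hx hrx => by have := H x hx 0 rfl hrx; simp only at this; linarith⟩

theorem GeometricAssumption.norm_sub_le {N : ℕ} {Ω : Set (Euc N)} {x₀ : Euc N} {ρ₀ d : ℝ}
    (h : GeometricAssumption Ω x₀ ρ₀ d) {x : Euc N} (hx : x ∈ Ω) : ‖x - x₀‖ ≤ d :=
  h.d_max.2 ⟨x, subset_closure hx, rfl⟩

theorem GeometricAssumption.d_nonneg {N : ℕ} {Ω : Set (Euc N)} {x₀ : Euc N} {ρ₀ d : ℝ}
    (h : GeometricAssumption Ω x₀ ρ₀ d) : 0 ≤ d :=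
  (norm_nonneg _).trans (h.norm_sub_le h.mem)

/-! ### Sobolev embedding of W^{1,1} into L² on the domain. -/

/-- The Gagliardo-Nirenberg-Sobolev inequality in the plane with exponents 1 and 2, which are the
Sobolev-conjugate pair there. -/
theorem integral_sq_le_of_contDiff_of_hasCompactSupport :
    ∃ C : ℝ, 0 < C ∧ ∀ f : Euc 2 → ℝ, ContDiff ℝ 1 f → HasCompactSupport f →
      ∫ x, f x ^ 2 ≤ C * (∫ x, ‖fderiv ℝ f x‖) ^ 2 := by
  have hconj : NNReal.HolderConjugate (Module.finrank ℝ (Euc 2)) (2 : ℝ≥0) := by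
    rw [finrank_euclideanSpace_fin]
    exact_mod_cast NNReal.HolderConjugate.two_two
  set C₀ := eLpNormLESNormFDerivOneConst (volume : Measure (Euc 2)) (2 : ℝ≥0) with hC₀
  refine ⟨(C₀ : ℝ) ^ 2 + 1, by positivity, fun f hf hc => ?_⟩
  have hS := eLpNorm_le_eLpNorm_fderiv_one (volume : Measure (Euc 2)) hf hc hconj
  have hf2 : MemLp f 2 volume := hf.continuous.memLp_of_hasCompactSupport hc
  have hcf : Continuous (fderiv ℝ f) := hf.continuous_fderiv (by simp)
  have hf1 : Integrable (fderiv ℝ f) := hcf.integrable_of_hasCompactSupport (hc.fderiv ℝ)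
  have e1 : eLpNorm (fderiv ℝ f) 1 volume = ENNReal.ofReal (∫ x, ‖fderiv ℝ f x‖) := by
    rw [eLpNorm_one_eq_lintegral_enorm, ofReal_integral_norm_eq_lintegral_enorm hf1]
  have hnn : 0 ≤ ∫ x, ‖fderiv ℝ f x‖ := integral_nonneg fun _ => norm_nonneg _
  have e2 : eLpNorm f 2 volume = ENNReal.ofReal ((∫ x, ‖f x‖ ^ (2 : ℝ)) ^ (2 : ℝ)⁻¹) := by
    simpa using hf2.eLpNorm_eq_integral_rpow_norm (by simp) (by simp)
  have hS' : eLpNorm f 2 volume ≤ C₀ * eLpNorm (fderiv ℝ f) 1 volume := by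
    simpa [hC₀] using hS
  rw [e1, e2, ← ENNReal.ofReal_coe_nnreal, ← ENNReal.ofReal_mul (by positivity),
    ENNReal.ofReal_le_ofReal_iff (by positivity)] at hS'
  have hI : 0 ≤ ∫ x, f x ^ 2 := integral_nonneg fun _ => sq_nonneg _
  have e3 : ∫ x, ‖f x‖ ^ (2 : ℝ) = ∫ x, f x ^ 2 := by
    refine integral_congr_ae (ae_of_all _ fun x => ?_)
    simp only [Real.rpow_two, Real.norm_eq_abs, sq_abs]
  rw [e3] at hS'
  have h4 := pow_le_pow_left₀ (by positivity) hS' 2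
  have h5 : ((∫ x, f x ^ 2) ^ (2 : ℝ)⁻¹) ^ 2 = ∫ x, f x ^ 2 := by
    rw [← Real.rpow_natCast, ← Real.rpow_mul hI]; norm_num
  rw [h5, mul_pow] at h4
  nlinarith [sq_nonneg (∫ x, ‖fderiv ℝ f x‖)]

theorem contDiff_mul_of_tsupport_subset {N : ℕ} {Ω : Set (Euc N)} {q g : Euc N → ℝ}
    (hq : ContDiff ℝ 1 q) (hs : tsupport q ⊆ Ω) (hΩ : IsOpen Ω) (hg : ContDiffOn ℝ 1 g Ω) :
    ContDiff ℝ 1 fun x => q x * g x :=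
  contMDiff_iff_contDiff.1 <| contMDiff_of_tsupport fun _ hx => contMDiffAt_iff_contDiffAt.2 <|
    hq.contDiffAt.mul (hg.contDiffAt (hΩ.mem_nhds (hs (tsupport_mul_subset_left hx))))

/-- The embedding of `W^{1,1}` into `L²` on a smooth star-shaped planar domain. -/
theorem exists_setIntegral_sq_le :
    ∃ C : ℝ, 0 < C ∧ ∀ (Ω : Set (Euc 2)) (x₀ : Euc 2) (ρ₀ d : ℝ), GeometricAssumption Ω x₀ ρ₀ d →
      ∀ w : Euc 2 → ℝ, ContDiffOn ℝ 1 w Ω → (∀ x ∈ Ω, 0 ≤ w x) →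
      ∀ M : ℝ, (∀ x ∈ Ω, w x ≤ M) → (∀ x ∈ Ω, ‖fderiv ℝ w x‖ ≤ M) →
      ∫ x in Ω, w x ^ 2 ≤ C * (∫ x in Ω, ‖fderiv ℝ w x‖ +
        2 / ρ₀ * (2 * w x + d * ‖fderiv ℝ w x‖)) ^ 2 := by
  obtain ⟨C, hC, hS⟩ := integral_sq_le_of_contDiff_of_hasCompactSupport
  refine ⟨C, hC, fun Ω x₀ ρ₀ d h w hw hw0 M hM hM' => ?_⟩
  obtain ⟨r, hr, hΩ, hl⟩ := h.exists_definingFunction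
  obtain ⟨ε₀, hε₀, hlay⟩ := h.exists_layer_radial hr hΩ hl
  have ho := h.domain.isOpen
  have hb := h.domain.isBounded
  have hρ := h.rho_pos
  have hd := h.d_nonneg
  have hM0 : 0 ≤ M := (hw0 x₀ h.mem).trans (hM x₀ h.mem)
  have hwc := hw.continuousOn
  have hDc : ContinuousOn (fderiv ℝ w) Ω := hw.continuousOn_fderiv_of_isOpen ho (by simp)
  have hwd : ∀ x ∈ Ω, DifferentiableAt ℝ w x := fun x hx =>
    (hw.differentiableOn (by simp)).differentiableAt (ho.mem_nhds hx)
  have iw : IntegrableOn w Ω := ho.integrableOn_of_bounded hb hwc (M := M) fun x hx => by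
    rw [abs_of_nonneg (hw0 x hx)]; exact hM x hx
  have iD : IntegrableOn (fun x => ‖fderiv ℝ w x‖) Ω :=
    ho.integrableOn_of_bounded hb hDc.norm (M := M) fun x hx => by
      rw [abs_of_nonneg (norm_nonneg _)]; exact hM' x hx
  have iw2 : IntegrableOn (fun x => w x ^ 2) Ω :=
    ho.integrableOn_of_bounded hb (hwc.pow 2) (M := M ^ 2) fun x hx => by
      rw [abs_of_nonneg (sq_nonneg _)]; exact pow_le_pow_left₀ (hw0 x hx) (hM x hx) 2
  set R := ∫ x in Ω, ‖fderiv ℝ w x‖ + 2 / ρ₀ * (2 * w x + d * ‖fderiv ℝ w x‖) with hR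
  have key : ∀ᶠ ε in 𝓝[>] (0 : ℝ), ∫ x in Ω, w x ^ 2 ≤
      C * R ^ 2 + 2 * M ^ 2 * ∫ x in Ω, (1 - sublevelCutoff r ε x) := by
    have h1 : ∀ᶠ ε : ℝ in 𝓝[>] 0, ε < ε₀ / 2 :=
      mem_nhdsWithin_of_mem_nhds (gt_mem_nhds (by linarith))
    filter_upwards [h1, self_mem_nhdsWithin] with ε hεlt hε
    replace hε : 0 < ε := hε
    set q := sublevelCutoff r ε with hq
    have hqs : ContDiff ℝ 1 q := (contDiff_sublevelCutoff hr).of_le (by simp)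
    have hqc : HasCompactSupport q := hasCompactSupport_sublevelCutoff hr hΩ hb hε
    have hqΩ : tsupport q ⊆ Ω := tsupport_sublevelCutoff_subset_domain hr hΩ hε
    have hq0 : ∀ x, 0 ≤ q x := sublevelCutoff_nonneg
    have hq1 : ∀ x, q x ≤ 1 := sublevelCutoff_le_one
    obtain ⟨η, hη0, hηΩ, hηD⟩ := exists_fderiv_sublevelCutoff hr hΩ hε
    have hDq : Continuous (fderiv ℝ q) := hqs.continuous_fderiv (by simp)
    have hfs : ContDiff ℝ 1 fun x => q x * w x := contDiff_mul_of_tsupport_subset hqs hqΩ ho hw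
    have hfc : HasCompactSupport fun x => q x * w x := hqc.mul_right
    -- Since ∇q = -η∇r and |∇r| ≤ (2/ρ₀) ∇r·(x - x₀) in the layer, |∇q| is at most -(2/ρ₀) ∇q·(x -
    -- x₀). This is linear in ∇q, so it can be integrated by parts.
    have hD : ∀ x ∈ Ω, ‖fderiv ℝ (fun x => q x * w x) x‖ ≤
        ‖fderiv ℝ w x‖ + 2 / ρ₀ * -(fderiv ℝ q x (x - x₀) * w x) := by
      intro x hx
      rw [((hqs.differentiable (by simp) x).hasFDerivAt.fun_mul (hwd x hx).hasFDerivAt).fderiv]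
      refine (norm_add_le _ _).trans (add_le_add ?_ ?_)
      · rw [norm_smul, Real.norm_of_nonneg (hq0 x)]
        exact mul_le_of_le_one_left (norm_nonneg _) (hq1 x)
      · rw [norm_smul, Real.norm_of_nonneg (hw0 x hx), hηD, norm_smul, norm_neg,
          Real.norm_of_nonneg (hη0 x)]
        by_cases h0 : η x = 0
        · simp [h0]
        · have := hlay x hx (by linarith [(hηΩ x h0).2])
          have h2 : ‖fderiv ℝ r x‖ ≤ 2 / ρ₀ * fderiv ℝ r x (x - x₀) := by
            rw [div_mul_eq_mul_div, le_div_iff₀ hρ]; linarith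
          have h3 := mul_le_mul_of_nonneg_left h2 (mul_nonneg (hw0 x hx) (hη0 x))
          simp only [smul_apply, smul_eq_mul]
          linarith
    have iq : IntegrableOn (fun x => fderiv ℝ q x (x - x₀) * w x) Ω := by
      have : ContinuousOn (fun x => fderiv ℝ q x (x - x₀)) (univ : Set (Euc 2)) := by fun_prop
      obtain ⟨B, hB⟩ := h.isCompact_closure.exists_bound_of_continuousOn
        (this.mono (subset_univ _))
      refine ho.integrableOn_of_bounded hb ((this.mono (subset_univ _)).mul hwc)
        (M := B * M) fun x hx => ?_
      rw [abs_mul]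
      have hBx := hB x (subset_closure hx)
      rw [abs_of_nonneg (hw0 x hx)]
      exact mul_le_mul hBx (hM x hx) (hw0 x hx) ((norm_nonneg _).trans hBx)
    have iqn : IntegrableOn (fun x => -(fderiv ℝ q x (x - x₀) * w x)) Ω := iq.neg
    -- The radial identity moves the derivative off the cutoff, so the bound does not depend on `ε`
    -- although |∇q| blows up as the layer shrinks.
    have htot : ∫ x, ‖fderiv ℝ (fun x => q x * w x) x‖ ≤ R := by
      have e1 : ∫ x in Ω, ‖fderiv ℝ (fun x => q x * w x) x‖ =
          ∫ x, ‖fderiv ℝ (fun x => q x * w x) x‖ :=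
        setIntegral_eq_integral_of_forall_compl_eq_zero fun x hx => by
          rw [fderiv_of_notMem_tsupport ℝ fun h' => hx (hqΩ (tsupport_mul_subset_left h')),
            norm_zero]
      have ifs : Integrable fun x => ‖fderiv ℝ (fun x => q x * w x) x‖ :=
        ((hfs.continuous_fderiv (by simp)).integrable_of_hasCompactSupport (hfc.fderiv ℝ)).norm
      have hrad := setIntegral_mul_radial_eq hqs hqc hqΩ ho hw x₀
      have irad : IntegrableOn (fun x => q x * (((2 : ℕ) : ℝ) * w x + fderiv ℝ w x (x - x₀))) Ω :=
        (integrable_mul_of_tsupport_subset hqs.continuous hqc hqΩ ho (by fun_prop)).integrableOn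
      rw [← e1]
      calc ∫ x in Ω, ‖fderiv ℝ (fun x => q x * w x) x‖
          ≤ ∫ x in Ω, ‖fderiv ℝ w x‖ + 2 / ρ₀ * -(fderiv ℝ q x (x - x₀) * w x) :=
            setIntegral_mono_on ifs.integrableOn (iD.add (iqn.const_mul _)) ho.measurableSet hD
        _ = (∫ x in Ω, ‖fderiv ℝ w x‖) +
            2 / ρ₀ * ∫ x in Ω, q x * (((2 : ℕ) : ℝ) * w x + fderiv ℝ w x (x - x₀)) := by
            rw [integral_add iD (iqn.const_mul _), integral_const_mul, integral_neg, hrad]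
        _ = ∫ x in Ω, ‖fderiv ℝ w x‖ +
            2 / ρ₀ * (q x * (((2 : ℕ) : ℝ) * w x + fderiv ℝ w x (x - x₀))) := by
            rw [integral_add iD (irad.const_mul _), integral_const_mul]
        _ ≤ R := by
            refine setIntegral_mono_on (iD.add (irad.const_mul _))
              (iD.add (((iw.const_mul 2).add (iD.const_mul d)).const_mul _)) ho.measurableSet
              fun x hx => ?_
            have h1 : fderiv ℝ w x (x - x₀) ≤ d * ‖fderiv ℝ w x‖ := by
              refine (le_abs_self _).trans (((fderiv ℝ w x).le_opNorm _).trans ?_)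
              rw [mul_comm]
              exact mul_le_mul_of_nonneg_right (h.norm_sub_le hx) (norm_nonneg _)
            have h2 : q x * (((2 : ℕ) : ℝ) * w x + fderiv ℝ w x (x - x₀)) ≤
                2 * w x + d * ‖fderiv ℝ w x‖ := by
              have h3 : 0 ≤ 2 * w x + d * ‖fderiv ℝ w x‖ :=
                add_nonneg (mul_nonneg zero_le_two (hw0 x hx)) (mul_nonneg hd (norm_nonneg _))
              refine le_trans (mul_le_mul_of_nonneg_left (b := ((2 : ℕ) : ℝ) * w x +
                fderiv ℝ w x (x - x₀)) (c := 2 * w x + d * ‖fderiv ℝ w x‖) ?_ (hq0 x))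
                (mul_le_of_le_one_left h3 (hq1 x))
              push_cast
              linarith
            gcongr
    have hR0 : 0 ≤ ∫ x, ‖fderiv ℝ (fun x => q x * w x) x‖ :=
      integral_nonneg fun _ => norm_nonneg _
    have hmain : ∫ x in Ω, (q x * w x) ^ 2 ≤ C * R ^ 2 := by
      have e2 : ∫ x in Ω, (q x * w x) ^ 2 = ∫ x, (q x * w x) ^ 2 :=
        setIntegral_eq_integral_of_forall_compl_eq_zero fun x hx => by
          rw [image_eq_zero_of_notMem_tsupport fun h' => hx (hqΩ h')]; simp
      rw [e2]
      exact (hS _ hfs hfc).trans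
        (mul_le_mul_of_nonneg_left (pow_le_pow_left₀ hR0 htot 2) hC.le)
    have i1 : IntegrableOn (fun x => (q x * w x) ^ 2) Ω :=
      ho.integrableOn_of_bounded hb ((hqs.continuous.continuousOn.mul hwc).pow 2) (M := M ^ 2)
        fun x hx => by
          rw [abs_of_nonneg (sq_nonneg _)]
          exact pow_le_pow_left₀ (mul_nonneg (hq0 x) (hw0 x hx))
            ((mul_le_of_le_one_left (hw0 x hx) (hq1 x)).trans (hM x hx)) 2
    have i2 : IntegrableOn (fun x => 1 - q x) Ω :=
      ho.integrableOn_of_bounded hb (continuous_const.sub hqs.continuous).continuousOn (M := 1)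
        fun x hx => by rw [abs_le]; constructor <;> linarith [hq0 x, hq1 x]
    calc ∫ x in Ω, w x ^ 2 ≤ ∫ x in Ω, (q x * w x) ^ 2 + 2 * M ^ 2 * (1 - q x) := by
          refine setIntegral_mono_on iw2 (i1.add (i2.const_mul _)) ho.measurableSet fun x hx => ?_
          have h1 : w x ^ 2 ≤ M ^ 2 := pow_le_pow_left₀ (hw0 x hx) (hM x hx) 2
          have h2 : (1 - q x ^ 2) * w x ^ 2 ≤ (1 - q x ^ 2) * M ^ 2 :=
            mul_le_mul_of_nonneg_left h1 (by nlinarith [hq0 x, hq1 x])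
          have h3 : (1 - q x ^ 2) * M ^ 2 ≤ 2 * (1 - q x) * M ^ 2 :=
            mul_le_mul_of_nonneg_right (by nlinarith [hq0 x, hq1 x, sq_nonneg (1 - q x)])
              (sq_nonneg M)
          nlinarith
      _ = (∫ x in Ω, (q x * w x) ^ 2) + 2 * M ^ 2 * ∫ x in Ω, (1 - q x) := by
          rw [integral_add i1 (i2.const_mul _), integral_const_mul]
      _ ≤ _ := by gcongr
  have hlim := ((tendsto_setIntegral_one_sub_sublevelCutoff hr hΩ hb).const_mul
    (2 * M ^ 2)).const_add (C * R ^ 2)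
  rw [mul_zero, add_zero] at hlim
  exact ge_of_tendsto hlim key

/-! ### Powers of a positive function with bounded gradient. -/

/-- `v` is continuously differentiable on `Ω`, with values between two positive constants and with
bounded gradient. -/
structure IsBoundedPositiveC1 {N : ℕ} (Ω : Set (Euc N)) (v : Euc N → ℝ) (μ M : ℝ) : Prop where
  contDiffOn : ContDiffOn ℝ 1 v Ω
  lower_pos : 0 < μ
  lower : ∀ x ∈ Ω, μ ≤ v x
  upper : ∀ x ∈ Ω, v x ≤ M
  fderiv_le : ∀ x ∈ Ω, ‖fderiv ℝ v x‖ ≤ M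

/-- The sum bounds the larger of the two endpoint values, which avoids a case split on the sign of
`β` wherever integrability is checked. -/
theorem Real.rpow_le_rpow_add_rpow_of_mem_Icc {x μ M : ℝ} (hμ : 0 < μ) (h1 : μ ≤ x) (h2 : x ≤ M)
    (β : ℝ) : x ^ β ≤ μ ^ β + M ^ β := by
  have hx := hμ.trans_le h1
  have hM := hx.trans_le h2
  rcases le_total 0 β with hβ | hβ
  · linarith [Real.rpow_le_rpow hx.le h2 hβ, Real.rpow_pos_of_pos hμ β]
  · linarith [Real.rpow_le_rpow_of_nonpos hμ h1 hβ, Real.rpow_pos_of_pos hM β]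

theorem Real.rpow_le_rpow_add_rpow {x α β γ : ℝ} (hx : 0 < x) (h1 : α ≤ β) (h2 : β ≤ γ) :
    x ^ β ≤ x ^ α + x ^ γ := by
  have ha := Real.rpow_pos_of_pos hx α
  have hc := Real.rpow_pos_of_pos hx γ
  rcases le_total 1 x with h | h
  · linarith [Real.rpow_le_rpow_of_exponent_le h h2]
  · linarith [Real.rpow_le_rpow_of_exponent_ge hx h h1]

namespace IsBoundedPositiveC1

variable {N : ℕ} {Ω : Set (Euc N)} {v : Euc N → ℝ} {μ M : ℝ}

theorem pos (hv : IsBoundedPositiveC1 Ω v μ M) {x : Euc N} (hx : x ∈ Ω) : 0 < v x :=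
  hv.lower_pos.trans_le (hv.lower x hx)

theorem hasFDerivAt_rpow (hv : IsBoundedPositiveC1 Ω v μ M) (hΩ : IsOpen Ω) {x : Euc N}
    (hx : x ∈ Ω) (β : ℝ) :
    HasFDerivAt (fun y => v y ^ β) ((β * v x ^ (β - 1)) • fderiv ℝ v x) x :=
  (((hv.contDiffOn.differentiableOn (by simp)).differentiableAt
    (hΩ.mem_nhds hx)).hasFDerivAt).rpow_const (Or.inl (hv.pos hx).ne')

theorem contDiffOn_rpow (hv : IsBoundedPositiveC1 Ω v μ M) (β : ℝ) :
    ContDiffOn ℝ 1 (fun y => v y ^ β) Ω :=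
  hv.contDiffOn.rpow_const_of_ne fun _ hx => (hv.pos hx).ne'

theorem norm_fderiv_rpow (hv : IsBoundedPositiveC1 Ω v μ M) (hΩ : IsOpen Ω) {x : Euc N}
    (hx : x ∈ Ω) {β : ℝ} (hβ : 0 ≤ β) :
    ‖fderiv ℝ (fun y => v y ^ β) x‖ = β * (v x ^ (β - 1) * ‖fderiv ℝ v x‖) := by
  rw [(hv.hasFDerivAt_rpow hΩ hx β).fderiv, norm_smul, Real.norm_of_nonneg, mul_assoc]
  exact mul_nonneg hβ (Real.rpow_pos_of_pos (hv.pos hx) _).le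

theorem continuousOn_norm_fderiv (hv : IsBoundedPositiveC1 Ω v μ M) (hΩ : IsOpen Ω) :
    ContinuousOn (fun x => ‖fderiv ℝ v x‖) Ω :=
  (hv.contDiffOn.continuousOn_fderiv_of_isOpen hΩ (by simp)).norm

theorem rpow_mul_norm_pow_le (hv : IsBoundedPositiveC1 Ω v μ M) {x : Euc N}
    (hx : x ∈ Ω) (β : ℝ) (j : ℕ) :
    |v x ^ β * ‖fderiv ℝ v x‖ ^ j| ≤ (μ ^ β + M ^ β) * M ^ j := by
  rw [abs_of_nonneg (mul_nonneg (Real.rpow_pos_of_pos (hv.pos hx) _).le (by positivity))]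
  have hM : 0 < M := (hv.pos hx).trans_le (hv.upper x hx)
  have h1 := Real.rpow_pos_of_pos hv.lower_pos β
  have h2 := Real.rpow_pos_of_pos hM β
  exact mul_le_mul (Real.rpow_le_rpow_add_rpow_of_mem_Icc hv.lower_pos (hv.lower x hx)
    (hv.upper x hx) β) (pow_le_pow_left₀ (norm_nonneg _) (hv.fderiv_le x hx) j) (by positivity)
    (by positivity)

theorem integrableOn_rpow_mul (hv : IsBoundedPositiveC1 Ω v μ M) (hΩ : IsOpen Ω)
    (hb : Bornology.IsBounded Ω) (β : ℝ) (j : ℕ) :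
    IntegrableOn (fun x => v x ^ β * ‖fderiv ℝ v x‖ ^ j) Ω :=
  hΩ.integrableOn_of_bounded hb
    ((hv.contDiffOn_rpow β).continuousOn.mul ((hv.continuousOn_norm_fderiv hΩ).pow j))
    fun _ hx => hv.rpow_mul_norm_pow_le hx β j

theorem integrableOn_rpow (hv : IsBoundedPositiveC1 Ω v μ M) (hΩ : IsOpen Ω)
    (hb : Bornology.IsBounded Ω) (β : ℝ) : IntegrableOn (fun x => v x ^ β) Ω := by
  simpa using hv.integrableOn_rpow_mul hΩ hb β 0

theorem integrableOn_rpow_mul_norm (hv : IsBoundedPositiveC1 Ω v μ M) (hΩ : IsOpen Ω)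
    (hb : Bornology.IsBounded Ω) (β : ℝ) :
    IntegrableOn (fun x => v x ^ β * ‖fderiv ℝ v x‖) Ω := by
  simpa using hv.integrableOn_rpow_mul hΩ hb β 1

theorem integrableOn_norm_fderiv_rpow (hv : IsBoundedPositiveC1 Ω v μ M) (hΩ : IsOpen Ω)
    (hb : Bornology.IsBounded Ω) {β : ℝ} (hβ : 0 ≤ β) :
    IntegrableOn (fun x => ‖fderiv ℝ (fun y => v y ^ β) x‖) Ω :=
  IntegrableOn.congr_fun ((hv.integrableOn_rpow_mul_norm hΩ hb (β - 1)).const_mul β)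
    (fun _ hx => (hv.norm_fderiv_rpow hΩ hx hβ).symm) hΩ.measurableSet

end IsBoundedPositiveC1

/-! ### The diffusion term and its boundary flux. -/

theorem continuousOn_laplacian {N : ℕ} {Ω : Set (Euc N)} {W : Euc N → ℝ} (hΩ : IsOpen Ω)
    (hW : ContDiffOn ℝ 2 W Ω) : ContinuousOn (Laplacian.laplacian W) Ω := by
  have h2 : ContDiffOn ℝ (1 + 1) W Ω := by rw [one_add_one_eq_two]; exact hW
  have hDW : ContDiffOn ℝ 1 (fderiv ℝ W) Ω := ((contDiffOn_succ_iff_fderiv_of_isOpen hΩ).1 h2).2.2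
  have hD2 : ContinuousOn (fderiv ℝ (fderiv ℝ W)) Ω :=
    hDW.continuousOn_fderiv_of_isOpen hΩ (by simp)
  rw [InnerProductSpace.laplacian_eq_iteratedFDeriv_orthonormalBasis W
    (EuclideanSpace.basisFun (Fin N) ℝ)]
  simp only [iteratedFDeriv_two_apply]
  refine continuousOn_finsetSum _ fun i _ => ?_
  exact (hD2.clm_apply continuousOn_const).clm_apply continuousOn_const

/-- Diffusion term tested against a power of the solution times a cutoff. The boundary flux is
controlled by the radial derivative of the cutoff. -/
theorem GeometricAssumption.setIntegral_mul_laplacian_rpow_le {Ω : Set (Euc 2)} {x₀ : Euc 2}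
    {ρ₀ d : ℝ} (h : GeometricAssumption Ω x₀ ρ₀ d) {r : Euc 2 → ℝ} (hr : ContDiff ℝ ∞ r)
    (hΩ : ∀ y, y ∈ Ω ↔ r y < 0) {v : Euc 2 → ℝ} {μ M : ℝ} (hv : IsBoundedPositiveC1 Ω v μ M)
    (hv2 : ContDiffOn ℝ 2 v Ω) {s m κ δ ε τ : ℝ} (hs : 1 ≤ s) (hm : 0 ≤ m) (hκ : 0 ≤ κ)
    (hδ : 0 ≤ δ) (hε : 0 < ε) (hτ : 0 ≤ τ)
    (hlay : ∀ x ∈ Ω, -(2 * ε) ≤ r x → v x ^ (s + m - 2) * fderiv ℝ r x (gradient v x) ≤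
      (κ * v x ^ τ + δ) * fderiv ℝ r x (x - x₀)) :
    ∫ x in Ω, sublevelCutoff r ε x * v x ^ (s - 1) *
        Laplacian.laplacian (fun y => v y ^ m) x ≤
      m * (κ * (∫ x in Ω, 2 * v x ^ τ + d * ‖fderiv ℝ (fun y => v y ^ τ) x‖) +
        2 * δ * volume.real Ω) := by
  have ho := h.domain.isOpen
  have hb := h.domain.isBounded
  have hd := h.d_nonneg
  set q := sublevelCutoff r ε with hq
  have hqs : ContDiff ℝ 1 q := (contDiff_sublevelCutoff hr).of_le (by simp)
  have hqc : HasCompactSupport q := hasCompactSupport_sublevelCutoff hr hΩ hb hε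
  have hqΩ : tsupport q ⊆ Ω := tsupport_sublevelCutoff_subset_domain hr hΩ hε
  have hq0 : ∀ x, 0 ≤ q x := sublevelCutoff_nonneg
  have hq1 : ∀ x, q x ≤ 1 := sublevelCutoff_le_one
  obtain ⟨η, hη0, hηΩ, hηD⟩ := exists_fderiv_sublevelCutoff hr hΩ hε
  have hQ : ContDiff ℝ 1 fun x => q x * v x ^ (s - 1) :=
    contDiff_mul_of_tsupport_subset hqs hqΩ ho (hv.contDiffOn_rpow _)
  have hQc : HasCompactSupport fun x => q x * v x ^ (s - 1) := hqc.mul_right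
  have hQΩ : (tsupport fun x => q x * v x ^ (s - 1)) ⊆ Ω :=
    (tsupport_mul_subset_left).trans hqΩ
  have hW : ContDiffOn ℝ 2 (fun y => v y ^ m) Ω :=
    hv2.rpow_const_of_ne fun _ hx => (hv.pos hx).ne'
  set w : Euc 2 → ℝ := fun x => κ * v x ^ τ + δ with hw
  have hws : ContDiffOn ℝ 1 w Ω := (contDiffOn_const.mul (hv.contDiffOn_rpow τ)).add contDiffOn_const
  rw [setIntegral_mul_laplacian_eq hQ hQc hQΩ ho hW, ← integral_neg]
  have hWc : ContinuousOn (gradient fun y => v y ^ m) Ω :=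
    (InnerProductSpace.toDual ℝ (Euc 2)).symm.continuous.comp_continuousOn
      (hW.continuousOn_fderiv_of_isOpen ho (by simp))
  -- The derivative falling on v^(s-1) gives a square with a favourable sign because `1 ≤ s`; it is
  -- discarded. The derivative falling on the cutoff is the flux, and `hlay` replaces ∇v by a
  -- multiple of x - x₀ there.
  have hpt : ∀ x ∈ Ω, -inner ℝ (gradient (fun x => q x * v x ^ (s - 1)) x)
      (gradient (fun y => v y ^ m) x) ≤ m * -(fderiv ℝ q x (x - x₀) * w x) := by
    intro x hx
    have hvx := hv.pos hx
    have e1 : gradient (fun y => v y ^ m) x = (m * v x ^ (m - 1)) • gradient v x := by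
      simp only [gradient, (hv.hasFDerivAt_rpow ho hx m).fderiv, map_smul]
    have e2 : v x ^ (m - 1) * v x ^ (s - 1) = v x ^ (s + m - 2) := by
      rw [← Real.rpow_add hvx]; congr 1; ring
    rw [e1, inner_gradient_left, ((hqs.differentiable (by simp) x).hasFDerivAt.fun_mul
      (hv.hasFDerivAt_rpow ho hx (s - 1))).fderiv, map_smul]
    have e3 : fderiv ℝ v x (gradient v x) = ‖gradient v x‖ ^ 2 := by
      rw [← inner_gradient_left, real_inner_self_eq_norm_sq]
    simp only [add_apply, smul_apply, smul_eq_mul, e3]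
    have p1 : 0 ≤ m * v x ^ (m - 1) * (q x * ((s - 1) * v x ^ (s - 1 - 1) *
        ‖gradient v x‖ ^ 2)) := by
      have := hq0 x
      have : 0 ≤ s - 1 := by linarith
      have := Real.rpow_pos_of_pos hvx (m - 1)
      have := Real.rpow_pos_of_pos hvx (s - 1 - 1)
      positivity
    have p2 : -(v x ^ (s + m - 2) * fderiv ℝ q x (gradient v x)) ≤
        -(fderiv ℝ q x (x - x₀) * w x) := by
      rw [hηD]
      simp only [smul_apply, smul_eq_mul]
      by_cases h0 : η x = 0
      · simp [h0]
      · have := mul_le_mul_of_nonneg_left (hlay x hx (hηΩ x h0).2) (hη0 x)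
        simp only [hw]
        linarith
    have p3 := mul_le_mul_of_nonneg_left p2 hm
    rw [← e2] at p3
    linarith
  have iq : IntegrableOn (fun x => fderiv ℝ q x (x - x₀) * w x) Ω := by
    have hc : Continuous fun x => fderiv ℝ q x (x - x₀) :=
      (hqs.continuous_fderiv (by simp)).clm_apply (by fun_prop)
    have hsup : (Function.support fun x => fderiv ℝ q x (x - x₀)) ⊆
        Function.support (fderiv ℝ q) := fun x hx h0 => hx (by
      change fderiv ℝ q x (x - x₀) = 0; rw [h0]; simp)
    have hcs : HasCompactSupport fun x => fderiv ℝ q x (x - x₀) := (hqc.fderiv ℝ).mono hsup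
    have hss : (tsupport fun x => fderiv ℝ q x (x - x₀)) ⊆ Ω :=
      (closure_mono hsup).trans ((tsupport_fderiv_subset ℝ).trans hqΩ)
    exact (integrable_mul_of_tsupport_subset hc hcs hss ho hws.continuousOn).integrableOn
  have iqn : IntegrableOn (fun x => -(fderiv ℝ q x (x - x₀) * w x)) Ω := iq.neg
  have iL : IntegrableOn (fun x => -inner ℝ (gradient (fun x => q x * v x ^ (s - 1)) x)
      (gradient (fun y => v y ^ m) x)) Ω := by
    have hc : Continuous (gradient fun x => q x * v x ^ (s - 1)) :=
      hQ.continuous_gradient (by simp)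
    have hc1 : ContinuousOn (fun x => inner ℝ (gradient (fun x => q x * v x ^ (s - 1)) x)
      (gradient (fun y => v y ^ m) x)) Ω := hc.continuousOn.inner hWc
    refine Integrable.neg ?_
    have hK : IsCompact (tsupport q) := hqc
    have h1 : IntegrableOn (fun x => inner ℝ (gradient (fun x => q x * v x ^ (s - 1)) x)
      (gradient (fun y => v y ^ m) x)) (tsupport q) := (hc1.mono hqΩ).integrableOn_compact hK
    refine (h1.integrable_of_forall_notMem_eq_zero fun x hx => ?_).integrableOn
    have : fderiv ℝ (fun x => q x * v x ^ (s - 1)) x = 0 :=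
      fderiv_of_notMem_tsupport ℝ fun h' => hx (tsupport_mul_subset_left h')
    simp [gradient, this]
  have hrad := setIntegral_mul_radial_eq hqs hqc hqΩ ho hws x₀
  have irad : IntegrableOn (fun x => q x * (((2 : ℕ) : ℝ) * w x + fderiv ℝ w x (x - x₀))) Ω := by
    have := hws.continuousOn
    have := hws.continuousOn_fderiv_of_isOpen ho (by simp)
    exact (integrable_mul_of_tsupport_subset hqs.continuous hqc hqΩ ho (by fun_prop)).integrableOn
  have iv := hv.integrableOn_rpow ho hb τ
  have iDv := hv.integrableOn_norm_fderiv_rpow ho hb hτ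
  have iE : IntegrableOn (fun x => 2 * v x ^ τ + d * ‖fderiv ℝ (fun y => v y ^ τ) x‖) Ω :=
    (iv.const_mul 2).add (iDv.const_mul d)
  have ic : IntegrableOn (fun _ : Euc 2 => 2 * δ) Ω := integrableOn_const hb.measure_lt_top.ne
  calc ∫ x in Ω, -inner ℝ (gradient (fun x => q x * v x ^ (s - 1)) x)
          (gradient (fun y => v y ^ m) x)
      ≤ ∫ x in Ω, m * -(fderiv ℝ q x (x - x₀) * w x) :=
        setIntegral_mono_on iL (iqn.const_mul m) ho.measurableSet hpt
    _ = m * ∫ x in Ω, q x * (((2 : ℕ) : ℝ) * w x + fderiv ℝ w x (x - x₀)) := by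
        rw [integral_const_mul, integral_neg, hrad]
    _ ≤ m * ∫ x in Ω, (κ * (2 * v x ^ τ + d * ‖fderiv ℝ (fun y => v y ^ τ) x‖) + 2 * δ) := by
        refine mul_le_mul_of_nonneg_left ?_ hm
        refine setIntegral_mono_on irad ((iE.const_mul κ).add ic) ho.measurableSet fun x hx => ?_
        have hvτ := Real.rpow_pos_of_pos (hv.pos hx) τ
        have e1 : fderiv ℝ w x = κ • fderiv ℝ (fun y => v y ^ τ) x := by
          have := ((((hv.hasFDerivAt_rpow ho hx τ).const_mul κ).add_const δ)).fderiv
          rw [hw, this, (hv.hasFDerivAt_rpow ho hx τ).fderiv]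
        have h1 : fderiv ℝ (fun y => v y ^ τ) x (x - x₀) ≤
            d * ‖fderiv ℝ (fun y => v y ^ τ) x‖ := by
          refine (le_abs_self _).trans (((fderiv ℝ (fun y => v y ^ τ) x).le_opNorm _).trans ?_)
          rw [mul_comm]
          exact mul_le_mul_of_nonneg_right (h.norm_sub_le hx) (norm_nonneg _)
        have h2 : ((2 : ℕ) : ℝ) * w x + fderiv ℝ w x (x - x₀) ≤
            κ * (2 * v x ^ τ + d * ‖fderiv ℝ (fun y => v y ^ τ) x‖) + 2 * δ := by
          rw [e1, smul_apply, smul_eq_mul]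
          have := mul_le_mul_of_nonneg_left h1 hκ
          simp only [hw]
          push_cast
          linarith
        exact (mul_le_mul_of_nonneg_left h2 (hq0 x)).trans
          (mul_le_of_le_one_left (by positivity) (hq1 x))
    _ = _ := by
        rw [integral_add (iE.const_mul κ) ic, integral_const_mul, setIntegral_const, smul_eq_mul]
        ring

/-! ### Interpolation, absorption and the energy estimate at a fixed time. -/

/-- Young's inequality AB ≤ θA² + B²/(4θ) with A = x^(α/2) n and B = x^(β/2). -/
theorem Real.rpow_mul_le_add {x n θ : ℝ} (hx : 0 < x) (hθ : 0 < θ) {α β γ : ℝ}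
    (hγ : 2 * γ = α + β) : x ^ γ * n ≤ θ * (x ^ α * n ^ 2) + 1 / (4 * θ) * x ^ β := by
  have e1 : x ^ γ = x ^ (α / 2) * x ^ (β / 2) := by rw [← Real.rpow_add hx]; congr 1; linarith
  have e2 : x ^ α = x ^ (α / 2) * x ^ (α / 2) := by rw [← Real.rpow_add hx]; congr 1; ring
  have e3 : x ^ β = x ^ (β / 2) * x ^ (β / 2) := by rw [← Real.rpow_add hx]; congr 1; ring
  rw [e1, e2, e3]
  set A := x ^ (α / 2)
  set B := x ^ (β / 2)
  have h : 0 ≤ 1 / (4 * θ) * (2 * θ * (A * n) - B) ^ 2 := by positivity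
  have e : 1 / (4 * θ) * (2 * θ * (A * n) - B) ^ 2 =
      θ * (A * A * n ^ 2) + 1 / (4 * θ) * (B * B) - A * B * n := by
    field_simp
    ring
  linarith

/-- Recovers Cauchy-Schwarz from the family of Young inequalities, by taking θ = Z/(2D). -/
theorem sq_le_mul_of_forall_le {Z D φ : ℝ} (hZ : 0 ≤ Z) (hD : 0 < D) (hφ : 0 ≤ φ)
    (h : ∀ θ > 0, Z ≤ θ * D + 1 / (4 * θ) * φ) : Z ^ 2 ≤ φ * D := by
  rcases hZ.eq_or_lt with h0 | hpos
  · rw [← h0]; simpa using mul_nonneg hφ hD.le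
  · have h1 := h (Z / (2 * D)) (by positivity)
    have e1 : Z / (2 * D) * D = Z / 2 := by field_simp
    have e2 : 1 / (4 * (Z / (2 * D))) * φ = φ * D / (2 * Z) := by field_simp; norm_num
    rw [e1, e2] at h1
    have h2 : Z / 2 ≤ φ * D / (2 * Z) := by linarith
    rw [le_div_iff₀ (by positivity)] at h2
    linarith

theorem Real.rpow_mul_rpow_le_add {x y α β : ℝ} (hx : 0 < x) (hy : 0 < y) (hα : 0 ≤ α)
    (hβ : 0 ≤ β) : x ^ α * y ^ β ≤ x ^ (α + β) + y ^ (α + β) := by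
  have h1 := Real.rpow_pos_of_pos hx (α + β)
  have h2 := Real.rpow_pos_of_pos hy (α + β)
  rcases le_total x y with h | h
  · have := mul_le_mul_of_nonneg_right (Real.rpow_le_rpow hx.le h hα)
      (Real.rpow_pos_of_pos hy β).le
    rw [← Real.rpow_add hy] at this
    linarith
  · have := mul_le_mul_of_nonneg_left (Real.rpow_le_rpow hy.le h hβ)
      (Real.rpow_pos_of_pos hx α).le
    rw [← Real.rpow_add hx] at this
    linarith

/-- Absorption of the superlinear term and of the gradient terms. -/
theorem exists_absorption_constants {A E K c : ℝ} (hA : 0 ≤ A) (hE : 0 ≤ E) (hK : 0 ≤ K)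
    (hc : 0 < c) :
    ∃ c₁ c₅ : ℝ, 0 < c₁ ∧ 0 < c₅ ∧ ∀ φ X D I : ℝ, 0 < φ → 0 ≤ D →
      (∀ lam > 0, X ≤ lam * K / 2 * (φ + D) + φ ^ 2 / (2 * lam)) →
      (∀ θ > 0, I ≤ A * (φ + X) + E * (θ * D + 1 / (4 * θ) * X)) →
      I - c * D ≤ c₁ * φ + c₅ * φ ^ 2 := by
  -- `θ` and `lam` are chosen so that each of the two resulting multiples of `D` is at most c/2. The
  -- summands 1 only guard against zero denominators.
  set θ := c / (2 * (E + 1)) with hθ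
  have hθ0 : 0 < θ := by positivity
  set A₁ := A + E * (1 / (4 * θ)) with hA₁
  have hA₁0 : 0 ≤ A₁ := by positivity
  set lam := c / (A₁ * K + 1) with hlam
  have hlam0 : 0 < lam := by positivity
  have h1 : E * θ ≤ c / 2 := by
    have e : E * θ = c / 2 * (E / (E + 1)) := by rw [hθ]; field_simp
    have : E / (E + 1) ≤ 1 := by rw [div_le_one (by positivity)]; linarith
    rw [e]; exact mul_le_of_le_one_right (by positivity) this
  have h2 : A₁ * (lam * K / 2) ≤ c / 2 := by
    have e : A₁ * (lam * K / 2) = c / 2 * (A₁ * K / (A₁ * K + 1)) := by rw [hlam]; field_simp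
    have : A₁ * K / (A₁ * K + 1) ≤ 1 := by rw [div_le_one (by positivity)]; linarith
    rw [e]; exact mul_le_of_le_one_right (by positivity) this
  refine ⟨A + c / 2, A₁ / (2 * lam) + 1, by positivity, by positivity, ?_⟩
  intro φ X D I hφ hD hX hI
  have h3 := hI θ hθ0
  have h4 := mul_le_mul_of_nonneg_left (hX lam hlam0) hA₁0
  have h5 := mul_le_mul_of_nonneg_right h1 hD
  have h6 := mul_le_mul_of_nonneg_right h2 (add_nonneg hφ.le hD)
  have e1 : A₁ * (φ ^ 2 / (2 * lam)) = A₁ / (2 * lam) * φ ^ 2 := by ring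
  have e2 : A * (φ + X) + E * (θ * D + 1 / (4 * θ) * X) = A * φ + A₁ * X + E * θ * D := by
    rw [hA₁]; ring
  rw [e2] at h3
  rw [mul_add, e1] at h4
  nlinarith [sq_nonneg φ]

namespace IsBoundedPositiveC1

variable {N : ℕ} {Ω : Set (Euc N)} {v : Euc N → ℝ} {μ M : ℝ}

theorem setIntegral_rpow_pos (hv : IsBoundedPositiveC1 Ω v μ M) (hΩ : IsOpen Ω)
    (hb : Bornology.IsBounded Ω) (hne : Ω.Nonempty) (β : ℝ) : 0 < ∫ x in Ω, v x ^ β := by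
  rw [setIntegral_pos_iff_support_of_nonneg_ae
    ((ae_restrict_iff' hΩ.measurableSet).2 (ae_of_all _ fun x hx =>
      (Real.rpow_pos_of_pos (hv.pos hx) β).le)) (hv.integrableOn_rpow hΩ hb β)]
  refine (hΩ.measure_pos volume hne).trans_le (measure_mono fun x hx => ⟨?_, hx⟩)
  exact (Real.rpow_pos_of_pos (hv.pos hx) β).ne'

/-- The exponent `j` lets one statement cover both uses: 1 for mixed terms with a gradient, 0 for
interpolation between pure powers. -/
theorem setIntegral_rpow_mul_norm_pow_le (hv : IsBoundedPositiveC1 Ω v μ M) (hΩ : IsOpen Ω)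
    (hb : Bornology.IsBounded Ω) {α β γ θ : ℝ} (hγ : 2 * γ = α + β) (hθ : 0 < θ) (j : ℕ) :
    ∫ x in Ω, v x ^ γ * ‖fderiv ℝ v x‖ ^ j ≤
      θ * (∫ x in Ω, v x ^ α * ‖fderiv ℝ v x‖ ^ (j * 2)) + 1 / (4 * θ) * ∫ x in Ω, v x ^ β := by
  have i1 := hv.integrableOn_rpow_mul hΩ hb α (j * 2)
  have i2 := hv.integrableOn_rpow hΩ hb β
  rw [← integral_const_mul, ← integral_const_mul,
    ← integral_add (i1.const_mul θ) (i2.const_mul _)]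
  refine setIntegral_mono_on (hv.integrableOn_rpow_mul hΩ hb γ j)
    ((i1.const_mul θ).add (i2.const_mul _)) hΩ.measurableSet fun x hx => ?_
  rw [pow_mul]
  exact Real.rpow_mul_le_add (hv.pos hx) hθ hγ

theorem setIntegral_rpow_le_add (hv : IsBoundedPositiveC1 Ω v μ M) (hΩ : IsOpen Ω)
    (hb : Bornology.IsBounded Ω) {α β γ : ℝ} (h1 : α ≤ β) (h2 : β ≤ γ) :
    ∫ x in Ω, v x ^ β ≤ (∫ x in Ω, v x ^ α) + ∫ x in Ω, v x ^ γ := by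
  have i1 := hv.integrableOn_rpow hΩ hb α
  have i2 := hv.integrableOn_rpow hΩ hb γ
  rw [← integral_add i1 i2]
  exact setIntegral_mono_on (hv.integrableOn_rpow hΩ hb β) (i1.add i2) hΩ.measurableSet
    fun x hx => Real.rpow_le_rpow_add_rpow (hv.pos hx) h1 h2

/-- Integrate x^α y^β ≤ x^(α+β) + y^(α+β) over pairs of points; this turns the nonlocal product into
a single integral without Hölder's inequality. -/
theorem setIntegral_rpow_mul_setIntegral_rpow_le (hv : IsBoundedPositiveC1 Ω v μ M)
    (hΩ : IsOpen Ω) (hb : Bornology.IsBounded Ω) {α β : ℝ} (hα : 0 ≤ α) (hβ : 0 ≤ β) :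
    (∫ x in Ω, v x ^ α) * (∫ x in Ω, v x ^ β) ≤
      2 * volume.real Ω * ∫ x in Ω, v x ^ (α + β) := by
  have ia := hv.integrableOn_rpow hΩ hb α
  have ib := hv.integrableOn_rpow hΩ hb β
  have iab := hv.integrableOn_rpow hΩ hb (α + β)
  have ic : ∀ r : ℝ, IntegrableOn (fun _ : Euc N => r) Ω := fun r =>
    integrableOn_const hb.measure_lt_top.ne
  have h1 : ∀ x ∈ Ω, v x ^ α * (∫ y in Ω, v y ^ β) ≤
      volume.real Ω * v x ^ (α + β) + ∫ y in Ω, v y ^ (α + β) := by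
    intro x hx
    rw [← integral_const_mul]
    have e : volume.real Ω * v x ^ (α + β) = ∫ y in Ω, v x ^ (α + β) := by
      rw [setIntegral_const, smul_eq_mul]
    rw [e, ← integral_add (ic _) iab]
    exact setIntegral_mono_on (ib.const_mul _) ((ic _).add iab) hΩ.measurableSet
      fun y hy => Real.rpow_mul_rpow_le_add (hv.pos hx) (hv.pos hy) hα hβ
  calc (∫ x in Ω, v x ^ α) * (∫ x in Ω, v x ^ β)
      = ∫ x in Ω, v x ^ α * ∫ y in Ω, v y ^ β := by rw [integral_mul_const]
    _ ≤ ∫ x in Ω, (volume.real Ω * v x ^ (α + β) + ∫ y in Ω, v y ^ (α + β)) :=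
        setIntegral_mono_on (ia.mul_const _) ((iab.const_mul _).add (ic _)) hΩ.measurableSet h1
    _ = _ := by
        rw [integral_add (iab.const_mul _) (ic _), integral_const_mul, setIntegral_const,
          smul_eq_mul]
        ring

end IsBoundedPositiveC1

/-- `L⁴`-type interpolation: `∫ v^{2s} ≤ K φ (φ + D)` with `φ = ∫ v^s`, `D = ∫ v^{s-2} |∇v|²`. -/
theorem exists_setIntegral_rpow_two_mul_le {s ρ₀ d : ℝ} (hs : 0 ≤ s) :
    ∃ K : ℝ, 0 ≤ K ∧ ∀ (Ω : Set (Euc 2)) (x₀ : Euc 2), GeometricAssumption Ω x₀ ρ₀ d →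
      ∀ (v : Euc 2 → ℝ) (μ M : ℝ), IsBoundedPositiveC1 Ω v μ M →
      ∫ x in Ω, v x ^ (2 * s) ≤ K * ((∫ x in Ω, v x ^ s) *
        ((∫ x in Ω, v x ^ s) + ∫ x in Ω, v x ^ (s - 2) * ‖fderiv ℝ v x‖ ^ 2)) := by
  obtain ⟨C, hC, hS⟩ := exists_setIntegral_sq_le
  refine ⟨2 * C * (((1 + 2 / ρ₀ * d) * s) ^ 2 + (4 / ρ₀) ^ 2), by positivity, ?_⟩
  intro Ω x₀ h v μ M hv
  have ho := h.domain.isOpen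
  have hb := h.domain.isBounded
  have hM : 0 < M := (hv.pos h.mem).trans_le (hv.upper _ h.mem)
  have hws := hv.contDiffOn_rpow s
  set φ := ∫ x in Ω, v x ^ s with hφ
  set D := ∫ x in Ω, v x ^ (s - 2) * ‖fderiv ℝ v x‖ ^ 2 with hD
  set Z := ∫ x in Ω, v x ^ (s - 1) * ‖fderiv ℝ v x‖ with hZ
  have hφ0 : 0 < φ := hv.setIntegral_rpow_pos ho hb ⟨x₀, h.mem⟩ s
  have hD0 : 0 ≤ D := setIntegral_nonneg ho.measurableSet fun x hx =>
    mul_nonneg (Real.rpow_pos_of_pos (hv.pos hx) _).le (by positivity)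
  have hZ0 : 0 ≤ Z := setIntegral_nonneg ho.measurableSet fun x hx =>
    mul_nonneg (Real.rpow_pos_of_pos (hv.pos hx) _).le (norm_nonneg _)
  -- `φ + D` replaces `D` because `D` may vanish, while the optimization in θ needs a positive
  -- factor.
  have hZ2 : Z ^ 2 ≤ φ * (φ + D) := by
    refine sq_le_mul_of_forall_le hZ0 (by positivity) hφ0.le fun θ hθ => ?_
    have := hv.setIntegral_rpow_mul_norm_pow_le ho hb (α := s - 2) (β := s) (γ := s - 1)
      (by ring) hθ 1
    simp only [pow_one, one_mul] at this
    have h2 : θ * D ≤ θ * (φ + D) := mul_le_mul_of_nonneg_left (by linarith) hθ.le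
    linarith
  have hSw := hS Ω x₀ ρ₀ d h _ hws (fun x hx => (Real.rpow_pos_of_pos (hv.pos hx) s).le)
    (μ ^ s + M ^ s + s * ((μ ^ (s - 1) + M ^ (s - 1)) * M)) (fun x hx => by
      have h1 := Real.rpow_le_rpow_add_rpow_of_mem_Icc hv.lower_pos (hv.lower x hx)
        (hv.upper x hx) s
      have h2 := Real.rpow_pos_of_pos hv.lower_pos (s - 1)
      have h3 := Real.rpow_pos_of_pos hM (s - 1)
      have : 0 ≤ s * ((μ ^ (s - 1) + M ^ (s - 1)) * M) := by positivity
      linarith) (fun x hx => by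
      rw [hv.norm_fderiv_rpow ho hx hs]
      have h1 := (le_abs_self _).trans (hv.rpow_mul_norm_pow_le hx (s - 1) 1)
      simp only [pow_one] at h1
      have h2 := Real.rpow_pos_of_pos hv.lower_pos s
      have h3 := Real.rpow_pos_of_pos hM s
      have := mul_le_mul_of_nonneg_left h1 hs
      linarith)
  have e1 : ∫ x in Ω, (v x ^ s) ^ 2 = ∫ x in Ω, v x ^ (2 * s) :=
    setIntegral_congr_fun ho.measurableSet fun x hx => by
      rw [mul_comm, Real.rpow_mul (hv.pos hx).le, Real.rpow_two]
  have i1 := hv.integrableOn_rpow ho hb s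
  have i2 := hv.integrableOn_rpow_mul_norm ho hb (s - 1)
  have e2 : (∫ x in Ω, ‖fderiv ℝ (fun y => v y ^ s) x‖ +
      2 / ρ₀ * (2 * v x ^ s + d * ‖fderiv ℝ (fun y => v y ^ s) x‖)) =
      (1 + 2 / ρ₀ * d) * s * Z + 4 / ρ₀ * φ := by
    rw [hZ, hφ, ← integral_const_mul, ← integral_const_mul,
      ← integral_add (i2.const_mul _) (i1.const_mul _)]
    refine setIntegral_congr_fun ho.measurableSet fun x hx => ?_
    rw [hv.norm_fderiv_rpow ho hx hs]
    ring
  rw [e1, e2] at hSw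
  refine hSw.trans ?_
  set α := (1 + 2 / ρ₀ * d) * s
  set β := 4 / ρ₀
  have h1 : (α * Z + β * φ) ^ 2 ≤ 2 * (α ^ 2 * Z ^ 2 + β ^ 2 * φ ^ 2) := by
    nlinarith [sq_nonneg (α * Z - β * φ)]
  have h2 : α ^ 2 * Z ^ 2 ≤ α ^ 2 * (φ * (φ + D)) := mul_le_mul_of_nonneg_left hZ2 (sq_nonneg _)
  have h3 : β ^ 2 * φ ^ 2 ≤ β ^ 2 * (φ * (φ + D)) :=
    mul_le_mul_of_nonneg_left (by nlinarith) (sq_nonneg _)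
  have h4 := mul_le_mul_of_nonneg_left (h1.trans (by linarith :
    2 * (α ^ 2 * Z ^ 2 + β ^ 2 * φ ^ 2) ≤ 2 * (α ^ 2 + β ^ 2) * (φ * (φ + D)))) hC.le
  linarith

/-- The differential inequality at a fixed time, in terms of the solution alone. -/
theorem exists_energy_constants {a c m κ s p ρ₀ d vol : ℝ} (ha : 0 ≤ a) (hc : 0 < c) (hm : 0 ≤ m)
    (hκ : 0 ≤ κ) (hs : 1 < s) (hp : 1 ≤ p) (hps : p - 1 ≤ s / 2) :
    ∃ c₁ c₅ : ℝ, 0 < c₁ ∧ 0 < c₅ ∧ ∀ (Ω : Set (Euc 2)) (x₀ : Euc 2),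
      GeometricAssumption Ω x₀ ρ₀ d → volume.real Ω = vol →
      ∀ (v : Euc 2 → ℝ) (μ M : ℝ), IsBoundedPositiveC1 Ω v μ M →
      s * (m * (κ * ∫ x in Ω, 2 * v x ^ (5 * s / 4) +
          d * ‖fderiv ℝ (fun y => v y ^ (5 * s / 4)) x‖) +
        a * ((∫ x in Ω, v x ^ p) * ∫ x in Ω, v x ^ (s - 1)) -
        c / 4 * ∫ x in Ω, v x ^ (s - 2) * ‖fderiv ℝ v x‖ ^ 2) ≤
      c₁ * (∫ x in Ω, v x ^ s) + c₅ * (∫ x in Ω, v x ^ s) ^ 2 := by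
  by_cases hd : 0 ≤ d
  swap
  · exact ⟨1, 1, one_pos, one_pos, fun Ω x₀ h => absurd h.d_nonneg hd⟩
  by_cases hvol : 0 ≤ vol
  swap
  · exact ⟨1, 1, one_pos, one_pos, fun Ω x₀ h hV => absurd (hV ▸ measureReal_nonneg) hvol⟩
  have hs0 : 0 ≤ s := by linarith
  obtain ⟨K, hK, hY⟩ := exists_setIntegral_rpow_two_mul_le (ρ₀ := ρ₀) (d := d) hs0
  obtain ⟨c₁, c₅, h1, h5, H⟩ := exists_absorption_constants
    (A := s * m * κ * 2 + s * a * (2 * vol)) (E := s * m * κ * d * (5 * s / 4)) (K := K)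
    (c := s * (c / 4)) (by positivity) (by positivity) hK (by positivity)
  refine ⟨c₁, c₅, h1, h5, fun Ω x₀ h hV v μ M hv => ?_⟩
  have ho := h.domain.isOpen
  have hb := h.domain.isBounded
  have hY' := hY Ω x₀ h v μ M hv
  set φ := ∫ x in Ω, v x ^ s with hφ
  set D := ∫ x in Ω, v x ^ (s - 2) * ‖fderiv ℝ v x‖ ^ 2 with hD
  set X := ∫ x in Ω, v x ^ (3 * s / 2) with hX
  have hφ0 : 0 < φ := hv.setIntegral_rpow_pos ho hb ⟨x₀, h.mem⟩ s
  have hD0 : 0 ≤ D := setIntegral_nonneg ho.measurableSet fun x hx =>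
    mul_nonneg (Real.rpow_pos_of_pos (hv.pos hx) _).le (by positivity)
  have iτ := hv.integrableOn_rpow ho hb (5 * s / 4)
  have iDτ := hv.integrableOn_norm_fderiv_rpow ho hb (β := 5 * s / 4) (by positivity)
  have b1 : ∫ x in Ω, v x ^ (5 * s / 4) ≤ φ + X :=
    hv.setIntegral_rpow_le_add ho hb (by linarith) (by linarith)
  have b2 : (∫ x in Ω, v x ^ p) * (∫ x in Ω, v x ^ (s - 1)) ≤ 2 * vol * (φ + X) := by
    rw [← hV] at hvol ⊢
    -- The total exponent p + s - 1 lies in [s, 3s/2], by `hp` and `hps`.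
    refine (hv.setIntegral_rpow_mul_setIntegral_rpow_le ho hb (by linarith) (by linarith)).trans
      (mul_le_mul_of_nonneg_left ?_ (by positivity))
    exact hv.setIntegral_rpow_le_add ho hb (by linarith) (by linarith)
  have e1 : (∫ x in Ω, 2 * v x ^ (5 * s / 4) +
      d * ‖fderiv ℝ (fun y => v y ^ (5 * s / 4)) x‖) = 2 * (∫ x in Ω, v x ^ (5 * s / 4)) +
      d * (5 * s / 4 * ∫ x in Ω, v x ^ (5 * s / 4 - 1) * ‖fderiv ℝ v x‖) := by
    rw [integral_add (iτ.const_mul 2) (iDτ.const_mul d), integral_const_mul, integral_const_mul,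
      ← integral_const_mul (5 * s / 4)]
    congr 2
    exact setIntegral_congr_fun ho.measurableSet fun x hx =>
      hv.norm_fderiv_rpow ho hx (by positivity)
  have hfin := H φ X D (s * (m * (κ * ∫ x in Ω, 2 * v x ^ (5 * s / 4) +
          d * ‖fderiv ℝ (fun y => v y ^ (5 * s / 4)) x‖) +
        a * ((∫ x in Ω, v x ^ p) * ∫ x in Ω, v x ^ (s - 1)))) hφ0 hD0 ?_ ?_
  · linarith
  · intro lam hlam
    -- Taking θ proportional to 1/φ cancels the factor φ in the interpolation inequality. The term
    -- in `D` then has a constant coefficient, and the remainder is quadratic in φ.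
    have := hv.setIntegral_rpow_mul_norm_pow_le ho hb (α := 2 * s) (β := s) (γ := 3 * s / 2)
      (by ring) (θ := lam / (2 * φ)) (by positivity) 0
    simp only [pow_zero, mul_one, zero_mul] at this
    refine this.trans ?_
    have h3 := mul_le_mul_of_nonneg_left hY' (by positivity : 0 ≤ lam / (2 * φ))
    have e3 : lam / (2 * φ) * (K * (φ * (φ + D))) = lam * K / 2 * (φ + D) := by field_simp
    have e4 : 1 / (4 * (lam / (2 * φ))) * φ = φ ^ 2 / (2 * lam) := by field_simp; norm_num
    rw [e3] at h3
    rw [← hφ, e4]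
    linarith
  · intro θ hθ
    have b3 := hv.setIntegral_rpow_mul_norm_pow_le ho hb (α := s - 2) (β := 3 * s / 2)
      (γ := 5 * s / 4 - 1) (by ring) hθ 1
    simp only [pow_one, one_mul] at b3
    rw [e1]
    have b1' := mul_le_mul_of_nonneg_left b1 (by positivity : 0 ≤ s * m * κ * 2)
    have b2' := mul_le_mul_of_nonneg_left b2 (by positivity : 0 ≤ s * a)
    have b3' := mul_le_mul_of_nonneg_left b3 (by positivity : 0 ≤ s * m * κ * d * (5 * s / 4))
    linarith

/-! ### Comparison with the ordinary differential equation. -/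

/-- Lower bound for the blow-up time of a solution of `φ' ≤ c₁ φ + c₅ φ²`. -/
theorem le_blowup_time_of_integral_le {φ : ℝ → ℝ} {c₁ c₅ T : ℝ} (h1 : 0 < c₁) (h5 : 0 < c₅)
    (hT : 0 < T) (hcont : ContinuousOn φ (Ico 0 T)) (hpos : ∀ t ∈ Ico 0 T, 0 < φ t)
    (hint : ∀ t ∈ Ioo 0 T, φ t - φ 0 ≤ ∫ τ in (0 : ℝ)..t, (c₁ * φ τ + c₅ * φ τ ^ 2))
    (hblow : Tendsto φ (𝓝[<] T) atTop) :
    1 / c₁ * Real.log (1 + c₁ / c₅ * (φ 0)⁻¹) ≤ T := by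
  -- Φ(y) is the integral of 1/(c₁η + c₅η²) over η > y: the time the comparison equation needs to go
  -- from y to infinity.
  set Φ : ℝ → ℝ := fun y => 1 / c₁ * Real.log (1 + c₁ / c₅ * y⁻¹) with hΦ
  have hφ0 : 0 < φ 0 := hpos 0 ⟨le_rfl, hT⟩
  have hΦanti : ∀ x y, 0 < x → x ≤ y → Φ y ≤ Φ x := fun x y hx hxy => by
    have hy := hx.trans_le hxy
    simp only [hΦ]
    gcongr
  have hΦd : ∀ y, 0 < y → HasDerivAt Φ (-(c₁ * y + c₅ * y ^ 2)⁻¹) y := by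
    intro y hy
    have hp : 0 < 1 + c₁ / c₅ * y⁻¹ := by positivity
    have := ((((hasDerivAt_inv hy.ne').const_mul (c₁ / c₅)).const_add 1).log hp.ne').const_mul
      (1 / c₁)
    refine this.congr_deriv ?_
    field_simp
    ring
  have main : ∀ t ∈ Ioo 0 T, Φ (φ 0) ≤ Φ (φ t) + t := by
    intro t ht
    set f : ℝ → ℝ := fun τ => c₁ * φ τ + c₅ * φ τ ^ 2 with hf
    have hsub : Icc 0 t ⊆ Ico 0 T := fun τ hτ => ⟨hτ.1, hτ.2.trans_lt ht.2⟩
    have hfc' : ContinuousOn f (Ico 0 T) :=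
      (continuousOn_const.mul hcont).add (continuousOn_const.mul (hcont.pow 2))
    have hfc : ContinuousOn f (Icc 0 t) := hfc'.mono hsub
    have hfi : ∀ τ ∈ Icc 0 t, IntervalIntegrable f volume 0 τ := fun τ hτ =>
      ContinuousOn.intervalIntegrable (by
        rw [uIcc_of_le hτ.1]; exact hfc.mono (Icc_subset_Icc_right hτ.2))
    have hf0 : ∀ τ ∈ Icc 0 t, 0 ≤ f τ := fun τ hτ => by
      have := hpos τ (hsub hτ)
      positivity
    -- φ is not known to be differentiable. Its majorant ψ is, with ψ' equal to the right-hand side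
    -- evaluated at φ, hence at most that evaluated at ψ.
    set ψ : ℝ → ℝ := fun τ => φ 0 + ∫ σ in (0 : ℝ)..τ, f σ with hψ
    have hψ0 : ∀ τ ∈ Icc 0 t, φ 0 ≤ ψ τ := fun τ hτ => by
      have : 0 ≤ ∫ σ in (0 : ℝ)..τ, f σ :=
        intervalIntegral.integral_nonneg hτ.1 fun σ hσ => hf0 σ ⟨hσ.1, hσ.2.trans hτ.2⟩
      simp only [hψ]; linarith
    have hφψ : ∀ τ ∈ Icc 0 t, φ τ ≤ ψ τ := fun τ hτ => by
      rcases hτ.1.eq_or_lt with h0 | h0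
      · rw [← h0]; simp [hψ]
      · have := hint τ ⟨h0, hτ.2.trans_lt ht.2⟩
        simp only [hψ]; linarith
    have hψc : ContinuousOn ψ (Icc 0 t) := by
      have := intervalIntegral.continuousOn_primitive_interval (μ := volume) (f := f) (a := 0)
        (b := t) (by rw [uIcc_of_le ht.1.le]; exact hfc.integrableOn_Icc)
      rw [uIcc_of_le ht.1.le] at this
      exact continuousOn_const.add this
    have hψd : ∀ τ ∈ Ioo 0 t, HasDerivAt ψ (f τ) τ := fun τ hτ => by
      have hmem : τ ∈ Icc 0 t := Ioo_subset_Icc_self hτ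
      have hnhds : Ioo 0 t ∈ 𝓝 τ := Ioo_mem_nhds hτ.1 hτ.2
      have hca : ContinuousAt f τ := hfc.continuousAt (mem_of_superset hnhds Ioo_subset_Icc_self)
      refine (intervalIntegral.integral_hasDerivAt_right (hfi τ hmem) ?_ hca).const_add _
      exact (hfc.mono Ioo_subset_Icc_self).stronglyMeasurableAtFilter isOpen_Ioo τ hτ
    have hGd : ∀ τ ∈ Ioo 0 t, HasDerivAt (fun σ => Φ (ψ σ) + σ)
        (-(c₁ * ψ τ + c₅ * ψ τ ^ 2)⁻¹ * f τ + 1) τ := fun τ hτ =>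
      ((hΦd _ (hφ0.trans_le (hψ0 τ (Ioo_subset_Icc_self hτ)))).comp τ (hψd τ hτ)).add
        (hasDerivAt_id τ)
    have hmono : MonotoneOn (fun σ => Φ (ψ σ) + σ) (Icc 0 t) := by
      refine monotoneOn_of_deriv_nonneg (convex_Icc 0 t) ?_ ?_ ?_
      · refine ContinuousOn.add (fun τ hτ => ?_) continuousOn_id
        exact (hΦd _ (hφ0.trans_le (hψ0 τ hτ))).continuousAt.comp_continuousWithinAt (hψc τ hτ)
      · rw [interior_Icc]
        exact fun τ hτ => (hGd τ hτ).differentiableAt.differentiableWithinAt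
      · rw [interior_Icc]
        intro τ hτ
        rw [(hGd τ hτ).deriv]
        have hm := Ioo_subset_Icc_self hτ
        have hp := hpos τ (hsub hm)
        have hψp := hφ0.trans_le (hψ0 τ hm)
        have hle : f τ ≤ c₁ * ψ τ + c₅ * ψ τ ^ 2 := by
          have := hφψ τ hm
          simp only [hf]
          gcongr
        have hden : 0 < c₁ * ψ τ + c₅ * ψ τ ^ 2 := by positivity
        have : (c₁ * ψ τ + c₅ * ψ τ ^ 2)⁻¹ * f τ ≤ 1 := by
          rw [inv_mul_le_iff₀ hden, mul_one]; exact hle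
        linarith
    have h0 := hmono (left_mem_Icc.2 ht.1.le) (right_mem_Icc.2 ht.1.le) ht.1.le
    have e0 : ψ 0 = φ 0 := by simp [hψ]
    simp only [e0, add_zero] at h0
    have := hΦanti _ _ (hpos t ⟨ht.1.le, ht.2⟩) (hφψ t (right_mem_Icc.2 ht.1.le))
    linarith
  have hlim : Tendsto (fun t => Φ (φ t) + t) (𝓝[<] T) (𝓝 T) := by
    have e1 : Tendsto (fun t => 1 + c₁ / c₅ * (φ t)⁻¹) (𝓝[<] T) (𝓝 1) := by
      simpa using ((tendsto_inv_atTop_zero.comp hblow).const_mul (c₁ / c₅)).const_add 1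
    have e2 : Tendsto (fun t => Φ (φ t)) (𝓝[<] T) (𝓝 0) := by
      have := (e1.log one_ne_zero).const_mul (1 / c₁)
      simpa [hΦ] using this
    simpa using e2.add (tendsto_id.mono_left nhdsWithin_le_nhds)
  refine ge_of_tendsto hlim ?_
  filter_upwards [Ioo_mem_nhdsLT hT] with t ht
  exact main t ht

/-! ### Regularity in time of the power integrals. -/

section Time

variable {N : ℕ} {Ω : Set (Euc N)} {T : ℝ} {u : Euc N → ℝ → ℝ} {Du : Euc N → ℝ → Euc N}

theorem IsC10.exists_bounds (hu : IsC10 Ω T u Du) (hc : IsCompact (closure Ω)) (hne : Ω.Nonempty)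
    (hpos : ∀ x ∈ closure Ω, ∀ t ∈ Ico 0 T, 0 < u x t) {t₂ : ℝ} (h0 : 0 ≤ t₂) (ht₂ : t₂ < T) :
    ∃ μ M : ℝ, 0 < μ ∧ ∀ x ∈ closure Ω, ∀ t ∈ Icc 0 t₂,
      μ ≤ u x t ∧ u x t ≤ M ∧ ‖Du x t‖ ≤ M := by
  have hsub : closure Ω ×ˢ Icc 0 t₂ ⊆ closure Ω ×ˢ Ico 0 T :=
    prod_mono_right fun τ hτ => ⟨hτ.1, hτ.2.trans_lt ht₂⟩
  have hK : IsCompact (closure Ω ×ˢ Icc 0 t₂) := hc.prod isCompact_Icc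
  obtain ⟨x, hx⟩ := hne
  have hKne : (closure Ω ×ˢ Icc 0 t₂).Nonempty := ⟨(x, 0), subset_closure hx, le_rfl, h0⟩
  obtain ⟨p, hp, hmin⟩ := hK.exists_isMinOn hKne (hu.cont.mono hsub)
  obtain ⟨M₁, hM₁⟩ := hK.exists_bound_of_continuousOn (hu.cont.mono hsub)
  obtain ⟨M₂, hM₂⟩ := hK.exists_bound_of_continuousOn (hu.cont_grad.mono hsub)
  refine ⟨u p.1 p.2, max M₁ M₂, hpos _ (hsub hp).1 _ (hsub hp).2, fun x hx t ht => ?_⟩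
  have hm : (x, t) ∈ closure Ω ×ˢ Icc 0 t₂ := ⟨hx, ht⟩
  exact ⟨hmin hm, ((le_abs_self _).trans (hM₁ _ hm)).trans (le_max_left _ _),
    (hM₂ _ hm).trans (le_max_right _ _)⟩

theorem IsC10.gradient_eq (hu : IsC10 Ω T u Du) {x : Euc N} (hx : x ∈ Ω) {t : ℝ}
    (ht : t ∈ Ico 0 T) : gradient (fun y => u y t) x = Du x t :=
  (hu.hasGradient x hx t ht).gradient

theorem IsC21.isBoundedPositiveC1 (hu : IsC10 Ω T u Du) (hr : IsC21 Ω T u) {μ M t : ℝ}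
    (hμ : 0 < μ) (ht : t ∈ Ioo 0 T)
    (hb : ∀ x ∈ closure Ω, μ ≤ u x t ∧ u x t ≤ M ∧ ‖Du x t‖ ≤ M) :
    IsBoundedPositiveC1 Ω (fun y => u y t) μ M where
  contDiffOn := (hr.contDiff_space t ht).of_le one_le_two
  lower_pos := hμ
  lower x hx := (hb x (subset_closure hx)).1
  upper x hx := (hb x (subset_closure hx)).2.1
  fderiv_le x hx := by
    rw [← norm_gradient_eq_norm_fderiv, hu.gradient_eq hx (Ioo_subset_Ico_self ht)]
    exact (hb x (subset_closure hx)).2.2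

/-- Weighted power integrals of the solution depend continuously on time. -/
theorem continuousOn_setIntegral_mul_rpow (hΩ : IsOpen Ω) (hbd : Bornology.IsBounded Ω)
    {q : Euc N → ℝ} (hq : Continuous q) (hq1 : ∀ x, |q x| ≤ 1) {S : Set ℝ}
    (hu : ContinuousOn (fun z : Euc N × ℝ => u z.1 z.2) (Ω ×ˢ S)) {M s : ℝ} (hs : 0 ≤ s)
    (hpos : ∀ x ∈ Ω, ∀ t ∈ S, 0 < u x t) (hM : ∀ x ∈ Ω, ∀ t ∈ S, u x t ≤ M) :
    ContinuousOn (fun t => ∫ x in Ω, q x * u x t ^ s) S := by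
  have hM' : ∀ x ∈ Ω, ∀ t ∈ S, |q x * u x t ^ s| ≤ M ^ s := fun x hx t ht => by
    rw [abs_mul, abs_of_nonneg (Real.rpow_pos_of_pos (hpos x hx t ht) s).le]
    exact (mul_le_of_le_one_left (Real.rpow_pos_of_pos (hpos x hx t ht) s).le (hq1 x)).trans
      (Real.rpow_le_rpow (hpos x hx t ht).le (hM x hx t ht) hs)
  refine continuousOn_of_dominated (bound := fun _ => M ^ s) (fun t ht => ?_) (fun t ht => ?_)
    (integrableOn_const hbd.measure_lt_top.ne) ?_
  · refine ContinuousOn.aestronglyMeasurable ?_ hΩ.measurableSet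
    have : ContinuousOn (fun x => u x t) Ω := hu.comp (f := fun x => (x, t)) (by fun_prop) fun x hx => ⟨hx, ht⟩
    exact hq.continuousOn.mul (this.rpow_const fun x hx => Or.inl (hpos x hx t ht).ne')
  · exact (ae_restrict_iff' hΩ.measurableSet).2 (ae_of_all _ fun x hx => hM' x hx t ht)
  · refine (ae_restrict_iff' hΩ.measurableSet).2 (ae_of_all _ fun x hx => ?_)
    have : ContinuousOn (fun t => u x t) S := hu.comp (f := fun t => (x, t)) (by fun_prop) fun t ht => ⟨hx, ht⟩
    exact continuousOn_const.mul (this.rpow_const fun t ht => Or.inl (hpos x hx t ht).ne')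

/-- Differentiation in time of a power integral weighted by a cutoff. -/
theorem IsC21.hasDerivAt_setIntegral_mul_rpow (hr : IsC21 Ω T u) (hΩ : IsOpen Ω)
    (hbd : Bornology.IsBounded Ω) {q : Euc N → ℝ} (hq : Continuous q) (hqc : HasCompactSupport q)
    (hqΩ : tsupport q ⊆ Ω) (hpos : ∀ x ∈ Ω, ∀ t ∈ Ioo 0 T, 0 < u x t) (s : ℝ) {t : ℝ}
    (ht : t ∈ Ioo 0 T) :
    IntegrableOn (fun x => q x * (s * u x t ^ (s - 1) * deriv (fun τ => u x τ) t)) Ω ∧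
    HasDerivAt (fun t => ∫ x in Ω, q x * u x t ^ s)
      (∫ x in Ω, q x * (s * u x t ^ (s - 1) * deriv (fun τ => u x τ) t)) t := by
  obtain ⟨t₁, ht₁⟩ := exists_between ht.1
  obtain ⟨t₂, ht₂⟩ := exists_between ht.2
  have hsub : Icc t₁ t₂ ⊆ Ioo 0 T := fun τ hτ => ⟨ht₁.1.trans_le hτ.1, hτ.2.trans_lt ht₂.2⟩
  have hcont : ContinuousOn (fun z : Euc N × ℝ =>
      q z.1 * (s * u z.1 z.2 ^ (s - 1) * deriv (fun τ => u z.1 τ) z.2)) (Ω ×ˢ Ioo 0 T) :=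
    (hq.comp continuous_fst).continuousOn.mul ((continuousOn_const.mul
      (hr.cont.rpow_const fun z hz => Or.inl (hpos _ hz.1 _ hz.2).ne')).mul hr.cont_time)
  -- The time derivative of the solution is controlled only inside the domain and for positive
  -- times, so the dominating constant comes from compactness of the cutoff's support times a closed
  -- time interval around `t`.
  obtain ⟨B, hB⟩ := ((show IsCompact (tsupport q) from hqc).prod
    (isCompact_Icc (a := t₁) (b := t₂))).exists_bound_of_continuousOn
    (hcont.mono (prod_mono hqΩ hsub))
  have hmeas : ∀ τ ∈ Ioo 0 T, ContinuousOn (fun x => q x * u x τ ^ s) Ω := fun τ hτ => by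
    have : ContinuousOn (fun x => u x τ) Ω :=
      hr.cont.comp (f := fun x => (x, τ)) (by fun_prop) fun x hx => ⟨hx, hτ⟩
    exact hq.continuousOn.mul (this.rpow_const fun x hx => Or.inl (hpos x hx τ hτ).ne')
  refine hasDerivAt_integral_of_dominated_loc_of_deriv_le (bound := fun _ => |B|)
    (F := fun τ x => q x * u x τ ^ s)
    (F' := fun τ x => q x * (s * u x τ ^ (s - 1) * deriv (fun τ => u x τ) τ))
    (Icc_mem_nhds ht₁.2 ht₂.1) ?_ ?_ ?_ ?_ (integrableOn_const hbd.measure_lt_top.ne) ?_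
  · filter_upwards [Ioo_mem_nhds ht.1 ht.2] with τ hτ
    exact (hmeas τ hτ).aestronglyMeasurable hΩ.measurableSet
  · have : ContinuousOn (fun x => u x t) Ω :=
      hr.cont.comp (f := fun x => (x, t)) (by fun_prop) fun x hx => ⟨hx, ht⟩
    exact (integrable_mul_of_tsupport_subset hq hqc hqΩ hΩ
      (this.rpow_const fun x hx => Or.inl (hpos x hx t ht).ne')).integrableOn
  · refine ContinuousOn.aestronglyMeasurable ?_ hΩ.measurableSet
    exact hcont.comp (f := fun x => (x, t)) (by fun_prop) fun x hx => ⟨hx, ht⟩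
  · refine (ae_restrict_iff' hΩ.measurableSet).2 (ae_of_all _ fun x _ τ hτ => ?_)
    by_cases hxq : x ∈ tsupport q
    · exact (hB (x, τ) ⟨hxq, hτ⟩).trans (le_abs_self B)
    · rw [image_eq_zero_of_notMem_tsupport hxq, zero_mul, norm_zero]; exact abs_nonneg B
  · refine (ae_restrict_iff' hΩ.measurableSet).2 (ae_of_all _ fun x hx τ hτ => ?_)
    have h1 := (hr.diff_time x hx τ (hsub hτ)).hasDerivAt.rpow_const (p := s)
      (Or.inl (hpos x hx τ (hsub hτ)).ne')
    exact (h1.const_mul (q x)).congr_deriv (by ring)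

end Time

/-! ### The differential inequality along the solution. -/

/-- Source of the damping: multiplied by u^(s-1), this is a quarter of the integrand u^(s-2)|∇u|² of
D. -/
theorem norm_gradient_sqrt_sq {N : ℕ} {Ω : Set (Euc N)} {v : Euc N → ℝ} {μ M : ℝ}
    (hv : IsBoundedPositiveC1 Ω v μ M) (hΩ : IsOpen Ω) {x : Euc N} (hx : x ∈ Ω) :
    ‖gradient (fun y => √(v y)) x‖ ^ 2 = 1 / 4 * (v x ^ (-1 : ℝ) * ‖fderiv ℝ v x‖ ^ 2) := by
  have hp := hv.pos hx
  have h1 := (((hv.contDiffOn.differentiableOn (by simp)).differentiableAt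
    (hΩ.mem_nhds hx)).hasFDerivAt).sqrt hp.ne'
  rw [norm_gradient_eq_norm_fderiv, h1.fderiv, norm_smul, mul_pow, Real.norm_eq_abs, sq_abs,
    div_pow, mul_pow, Real.sq_sqrt hp.le, Real.rpow_neg_one]
  field_simp
  ring

section Solution

variable {a b c k m p q s κ ρ₀ d : ℝ} {Ω : Set (Euc 2)} {x₀ : Euc 2}
  {g : ℝ → ℝ} {u₀ : Euc 2 → ℝ} {T : ℝ} {u : Euc 2 → ℝ → ℝ} {Du : Euc 2 → ℝ → Euc 2}

/-- Near the boundary the flux of the solution is dominated by a multiple of the radial derivative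
of the defining function, uniformly on compact time intervals. -/
theorem GeometricAssumption.exists_layer_flux (h : GeometricAssumption Ω x₀ ρ₀ d)
    {r : Euc 2 → ℝ} (hr : ContDiff ℝ ∞ r) (hΩ : ∀ y, y ∈ Ω ↔ r y < 0)
    (hl : ∀ z ∈ frontier Ω, IsLocalDefiningFunction Ω z r) (hk : 0 < k)
    (hg : ∀ ξ : ℝ, 0 ≤ ξ → g ξ ≤ k * ξ ^ (s / 4 - m + 2)) (hu : IsC10 Ω T u Du)
    (hpos : ∀ x ∈ closure Ω, ∀ t ∈ Ico 0 T, 0 < u x t)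
    (hflux : ∀ t ∈ Ico 0 T, ∀ z ν : Euc 2, IsOutwardUnitNormal Ω z ν →
      inner ℝ (Du z t) ν = g (u z t))
    {t₂ : ℝ} (ht₂ : t₂ < T) {δ : ℝ} (hδ : 0 < δ) :
    ∃ ε > 0, ∀ x ∈ Ω, ∀ t ∈ Icc 0 t₂, -ε ≤ r x →
      u x t ^ (s + m - 2) * fderiv ℝ r x (gradient (fun y => u y t) x) ≤
        (k / ρ₀ * u x t ^ (5 * s / 4) + δ) * fderiv ℝ r x (x - x₀) := by
  have hρ := h.rho_pos
  have hsub : closure Ω ×ˢ Icc 0 t₂ ⊆ closure Ω ×ˢ Ico 0 T :=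
    prod_mono_right fun τ hτ => ⟨hτ.1, hτ.2.trans_lt ht₂⟩
  have hc : Continuous (fderiv ℝ r) := hr.continuous_fderiv (by simp)
  have huc := hu.cont.mono hsub
  have hDuc := hu.cont_grad.mono hsub
  have hrp : ∀ β : ℝ, ContinuousOn (fun z : Euc 2 × ℝ => u z.1 z.2 ^ β)
      (closure Ω ×ˢ Icc 0 t₂) := fun β =>
    huc.rpow_const fun z hz => Or.inl (hpos _ (hsub hz).1 _ (hsub hz).2).ne'
  have hc1 : ContinuousOn (fun z : Euc 2 × ℝ => fderiv ℝ r z.1) (closure Ω ×ˢ Icc 0 t₂) :=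
    (hc.comp continuous_fst).continuousOn
  have hA : ContinuousOn (fun z : Euc 2 × ℝ =>
      (k / ρ₀ * u z.1 z.2 ^ (5 * s / 4) + δ) * fderiv ℝ r z.1 (z.1 - x₀) -
        u z.1 z.2 ^ (s + m - 2) * fderiv ℝ r z.1 (Du z.1 z.2)) (closure Ω ×ˢ Icc 0 t₂) :=
    (((continuousOn_const.mul (hrp _)).add continuousOn_const).mul
      (hc1.clm_apply (by fun_prop))).sub ((hrp _).mul (hc1.clm_apply hDuc))
  -- On the boundary the flux condition and (x - x₀)·ν ≥ ρ₀ give the inequality with δ = 0. A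
  -- positive δ makes it strict, so it persists in a layer.
  obtain ⟨ε, hε, H⟩ := exists_layer_pos hr.continuous hΩ h.isCompact_closure
    (isCompact_Icc (a := 0) (b := t₂)) hA (fun z hz t ht => by
      have ht' : t ∈ Ico 0 T := ⟨ht.1, ht.2.trans_lt ht₂⟩
      have hn : 0 < ‖gradient r z‖ := norm_pos_iff.2 (hl z hz).2.1
      have hup := hpos z (frontier_subset_closure hz) t ht'
      have h1 := h.rho_mul_norm_gradient_le (hl z hz) hz
      rw [real_inner_comm, inner_gradient_left] at h1
      have h2 := hflux t ht' z _ ((hl z hz).isOutwardUnitNormal hz)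
      rw [inner_smul_right, real_inner_comm, inner_gradient_left, inv_mul_eq_iff_eq_mul₀ hn.ne']
        at h2
      have h3 := hg _ hup.le
      have e1 : u z t ^ (s + m - 2) * u z t ^ (s / 4 - m + 2) = u z t ^ (5 * s / 4) := by
        rw [← Real.rpow_add hup]; congr 1; ring
      have p1 := Real.rpow_pos_of_pos hup (s + m - 2)
      have p2 := Real.rpow_pos_of_pos hup (5 * s / 4)
      have h4 : u z t ^ (s + m - 2) * fderiv ℝ r z (Du z t) ≤
          k * u z t ^ (5 * s / 4) * ‖gradient r z‖ := by
        rw [h2, ← e1]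
        have := mul_le_mul_of_nonneg_left h3 (mul_pos p1 hn).le
        linarith
      have h5 : ‖gradient r z‖ ≤ fderiv ℝ r z (z - x₀) / ρ₀ := by
        rw [le_div_iff₀ hρ]; linarith
      have h6 := mul_le_mul_of_nonneg_left h5 (mul_pos hk p2).le
      have h7 : 0 < fderiv ℝ r z (z - x₀) := (mul_pos hρ hn).trans_le h1
      have h8 : k * u z t ^ (5 * s / 4) * (fderiv ℝ r z (z - x₀) / ρ₀) =
          k / ρ₀ * u z t ^ (5 * s / 4) * fderiv ℝ r z (z - x₀) := by ring
      have h9 := mul_pos hδ h7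
      simp only
      linarith)
  refine ⟨ε, hε, fun x hx t ht hrx => ?_⟩
  have := H x hx t ht hrx
  simp only at this
  rw [hu.gradient_eq hx ⟨ht.1, ht.2.trans_lt ht₂⟩]
  linarith

/-- Differential inequality for the power integral weighted by a cutoff, at a fixed time. -/
theorem IsClassicalSolution.setIntegral_cutoff_deriv_le
    (hsol : IsClassicalSolution Ω a b c m p q g u₀ T u) (h : GeometricAssumption Ω x₀ ρ₀ d)
    (ha : 0 ≤ a) (hb : 0 ≤ b) (hc : 0 ≤ c) (hm : 0 ≤ m) (hs : 1 ≤ s) (hκ : 0 ≤ κ)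
    {r : Euc 2 → ℝ} (hr : ContDiff ℝ ∞ r) (hΩ : ∀ y, y ∈ Ω ↔ r y < 0)
    {t : ℝ} (ht : t ∈ Ioo 0 T) {μ M : ℝ} (hv : IsBoundedPositiveC1 Ω (fun y => u y t) μ M)
    {δ ε : ℝ} (hδ : 0 ≤ δ) (hε : 0 < ε)
    (hlay : ∀ x ∈ Ω, -(2 * ε) ≤ r x →
      u x t ^ (s + m - 2) * fderiv ℝ r x (gradient (fun y => u y t) x) ≤
        (κ * u x t ^ (5 * s / 4) + δ) * fderiv ℝ r x (x - x₀)) :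
    ∫ x in Ω, sublevelCutoff r ε x * (s * u x t ^ (s - 1) * deriv (fun τ => u x τ) t) ≤
      s * (m * (κ * ∫ x in Ω, 2 * u x t ^ (5 * s / 4) +
          d * ‖fderiv ℝ (fun y => u y t ^ (5 * s / 4)) x‖) +
        a * ((∫ x in Ω, u x t ^ p) * ∫ x in Ω, u x t ^ (s - 1)) -
        c / 4 * ∫ x in Ω, u x t ^ (s - 2) * ‖fderiv ℝ (fun y => u y t) x‖ ^ 2) +
      s * (m * (2 * δ * volume.real Ω) + c / 4 * ((μ ^ (s - 2) + M ^ (s - 2)) * M ^ 2) *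
        ∫ x in Ω, (1 - sublevelCutoff r ε x)) := by
  have ho := h.domain.isOpen
  have hbd := h.domain.isBounded
  have hs0 : 0 ≤ s := by linarith
  have hΔ := h.setIntegral_mul_laplacian_rpow_le hr hΩ hv (hsol.regular.contDiff_space t ht) hs hm
    hκ hδ hε (τ := 5 * s / 4) (by positivity) hlay
  have hqs : ContDiff ℝ ∞ (sublevelCutoff r ε) := contDiff_sublevelCutoff hr
  have hqc := hasCompactSupport_sublevelCutoff hr hΩ hbd hε
  have hqΩ := tsupport_sublevelCutoff_subset_domain hr hΩ hε
  have iL := (hsol.regular.hasDerivAt_setIntegral_mul_rpow ho hbd hqs.continuous hqc hqΩ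
    (fun x hx t ht => hsol.pos x (subset_closure hx) t (Ioo_subset_Ico_self ht)) s ht).1
  set η := sublevelCutoff r ε with hη
  have hη0 : ∀ x, 0 ≤ η x := sublevelCutoff_nonneg
  have hη1 : ∀ x, η x ≤ 1 := sublevelCutoff_le_one
  set P := ∫ x in Ω, u x t ^ p with hP
  have hP0 : 0 ≤ P := setIntegral_nonneg ho.measurableSet fun x hx =>
    (Real.rpow_pos_of_pos (hv.pos hx) _).le
  set M₂ := (μ ^ (s - 2) + M ^ (s - 2)) * M ^ 2 with hM₂
  have hW : ContDiffOn ℝ 2 (fun y => u y t ^ m) Ω :=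
    (hsol.regular.contDiff_space t ht).rpow_const_of_ne fun _ hx => (hv.pos hx).ne'
  have iΔ : IntegrableOn (fun x => η x * u x t ^ (s - 1) *
      Laplacian.laplacian (fun y => u y t ^ m) x) Ω := by
    have := integrable_mul_of_tsupport_subset hqs.continuous hqc hqΩ ho
      ((hv.contDiffOn_rpow (s - 1)).continuousOn.mul (continuousOn_laplacian ho hW))
    refine (this.congr (ae_of_all _ fun x => ?_)).integrableOn
    exact (mul_assoc _ _ _).symm
  have i1 := hv.integrableOn_rpow ho hbd (s - 1)
  have i2 := hv.integrableOn_rpow_mul ho hbd (s - 2) 2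
  have i3 : IntegrableOn (fun x => 1 - η x) Ω :=
    ho.integrableOn_of_bounded hbd (continuous_const.sub hqs.continuous).continuousOn (M := 1)
      fun x hx => by rw [abs_le]; constructor <;> linarith [hη0 x, hη1 x]
  -- The good gradient term arrives multiplied by the cutoff, but the energy estimate needs it in
  -- full. The missing part 1 - η is bounded using `M₂` and becomes an error that vanishes with `ε`.
  have hpt : ∀ x ∈ Ω, η x * (s * u x t ^ (s - 1) * deriv (fun τ => u x τ) t) ≤
      s * (η x * u x t ^ (s - 1) * Laplacian.laplacian (fun y => u y t ^ m) x) +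
      (s * a * P * u x t ^ (s - 1) -
        s * (c / 4) * (u x t ^ (s - 2) * ‖fderiv ℝ (fun y => u y t) x‖ ^ 2) +
      s * (c / 4) * M₂ * (1 - η x)) := by
    intro x hx
    have hp := hv.pos hx
    have hgr := norm_gradient_sqrt_sq hv ho hx
    rw [hsol.pde x hx t ht, hgr]
    have e1 : u x t ^ (s - 1) * u x t ^ (-1 : ℝ) = u x t ^ (s - 2) := by
      rw [← Real.rpow_add hp]; congr 1; ring
    have hbound := (le_abs_self _).trans (hv.rpow_mul_norm_pow_le hx (s - 2) 2)
    set G := ‖fderiv ℝ (fun y => u y t) x‖ ^ 2 with hG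
    set L := Laplacian.laplacian (fun y => u y t ^ m) x
    have p1 := Real.rpow_pos_of_pos hp (s - 1)
    have p2 := Real.rpow_pos_of_pos hp q
    have t1 : 0 ≤ η x * s * u x t ^ (s - 1) * (b * u x t ^ q) := by
      have := hη0 x
      positivity
    have t2 : η x * (s * a * P * u x t ^ (s - 1)) ≤ s * a * P * u x t ^ (s - 1) :=
      mul_le_of_le_one_left (by positivity) (hη1 x)
    have t3 : s * (c / 4) * (1 - η x) * (u x t ^ (s - 2) * G) ≤
        s * (c / 4) * (1 - η x) * M₂ :=
      mul_le_mul_of_nonneg_left hbound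
        (mul_nonneg (by positivity) (by linarith [hη1 x]))
    have e2 : η x * (s * u x t ^ (s - 1) * (L + a * P - b * u x t ^ q -
        c * (1 / 4 * (u x t ^ (-1 : ℝ) * G)))) =
        s * (η x * u x t ^ (s - 1) * L) + η x * (s * a * P * u x t ^ (s - 1)) -
        η x * s * u x t ^ (s - 1) * (b * u x t ^ q) -
        s * (c / 4) * η x * (u x t ^ (s - 2) * G) := by rw [← e1]; ring
    rw [e2]
    linarith
  have iR : IntegrableOn (fun x => s * a * P * u x t ^ (s - 1) -
        s * (c / 4) * (u x t ^ (s - 2) * ‖fderiv ℝ (fun y => u y t) x‖ ^ 2)) Ω :=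
    (i1.const_mul _).sub (i2.const_mul _)
  have iR' : IntegrableOn (fun x => s * a * P * u x t ^ (s - 1) -
        s * (c / 4) * (u x t ^ (s - 2) * ‖fderiv ℝ (fun y => u y t) x‖ ^ 2) +
        s * (c / 4) * M₂ * (1 - η x)) Ω := iR.add (i3.const_mul _)
  have hmono := setIntegral_mono_on iL ((iΔ.const_mul s).add iR') ho.measurableSet hpt
  refine hmono.trans ?_
  have eI : ∫ x in Ω, (s * (η x * u x t ^ (s - 1) * Laplacian.laplacian (fun y => u y t ^ m) x) +
      (s * a * P * u x t ^ (s - 1) -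
        s * (c / 4) * (u x t ^ (s - 2) * ‖fderiv ℝ (fun y => u y t) x‖ ^ 2) +
      s * (c / 4) * M₂ * (1 - η x))) =
      s * (∫ x in Ω, η x * u x t ^ (s - 1) * Laplacian.laplacian (fun y => u y t ^ m) x) +
      (s * a * P * (∫ x in Ω, u x t ^ (s - 1)) -
        s * (c / 4) * (∫ x in Ω, u x t ^ (s - 2) * ‖fderiv ℝ (fun y => u y t) x‖ ^ 2) +
      s * (c / 4) * M₂ * ∫ x in Ω, (1 - η x)) := by
    rw [integral_add (iΔ.const_mul s) iR', integral_add iR (i3.const_mul _),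
      integral_sub (i1.const_mul _) (i2.const_mul _), integral_const_mul, integral_const_mul,
      integral_const_mul, integral_const_mul]
  have h1 := mul_le_mul_of_nonneg_left hΔ hs0
  refine eI.le.trans ?_
  linarith

/-- Integrated form of the differential inequality `φ' ≤ c₁ φ + c₅ φ²`. -/
theorem IsClassicalSolution.setIntegral_sub_le
    (hsol : IsClassicalSolution Ω a b c m p q g u₀ T u) (h : GeometricAssumption Ω x₀ ρ₀ d)
    (ha : 0 ≤ a) (hb : 0 ≤ b) (hc : 0 ≤ c) (hk : 0 < k) (hm : 0 ≤ m) (hs : 1 ≤ s)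
    (hg : ∀ ξ : ℝ, 0 ≤ ξ → g ξ ≤ k * ξ ^ (s / 4 - m + 2)) {F : ℝ → ℝ} (hF : Continuous F)
    (henergy : ∀ (v : Euc 2 → ℝ) (μ M : ℝ), IsBoundedPositiveC1 Ω v μ M →
      s * (m * (k / ρ₀ * ∫ x in Ω, 2 * v x ^ (5 * s / 4) +
          d * ‖fderiv ℝ (fun y => v y ^ (5 * s / 4)) x‖) +
        a * ((∫ x in Ω, v x ^ p) * ∫ x in Ω, v x ^ (s - 1)) -
        c / 4 * ∫ x in Ω, v x ^ (s - 2) * ‖fderiv ℝ v x‖ ^ 2) ≤ F (∫ x in Ω, v x ^ s))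
    {t₂ : ℝ} (ht₂ : t₂ ∈ Ioo 0 T) :
    (∫ x in Ω, u x t₂ ^ s) - (∫ x in Ω, u x 0 ^ s) ≤
      ∫ t in (0 : ℝ)..t₂, F (∫ x in Ω, u x t ^ s) := by
  have ho := h.domain.isOpen
  have hbd := h.domain.isBounded
  have hs0 : 0 ≤ s := by linarith
  have hne : Ω.Nonempty := ⟨x₀, h.mem⟩
  obtain ⟨Du, hu, hflux⟩ := hsol.boundary
  obtain ⟨r, hr, hΩ, hl⟩ := h.exists_definingFunction
  obtain ⟨μ, M, hμ, hbounds⟩ := hu.exists_bounds h.isCompact_closure hne hsol.pos ht₂.1.le ht₂.2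
  have hsub : Icc 0 t₂ ⊆ Ico 0 T := fun τ hτ => ⟨hτ.1, hτ.2.trans_lt ht₂.2⟩
  have hposΩ : ∀ x ∈ Ω, ∀ t ∈ Icc 0 t₂, 0 < u x t := fun x hx t ht =>
    hsol.pos x (subset_closure hx) t (hsub ht)
  have hM : ∀ x ∈ Ω, ∀ t ∈ Icc 0 t₂, u x t ≤ M := fun x hx t ht =>
    (hbounds x (subset_closure hx) t ht).2.1
  have hucont : ContinuousOn (fun z : Euc 2 × ℝ => u z.1 z.2) (Ω ×ˢ Icc 0 t₂) :=
    hu.cont.mono (prod_mono subset_closure hsub)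
  have hwcont : ∀ f : Euc 2 → ℝ, Continuous f → (∀ x, |f x| ≤ 1) →
      ContinuousOn (fun t => ∫ x in Ω, f x * u x t ^ s) (Icc 0 t₂) := fun f hf hf1 =>
    continuousOn_setIntegral_mul_rpow ho hbd hf hf1 hucont hs0 hposΩ hM
  have hφcont : ContinuousOn (fun t => ∫ x in Ω, u x t ^ s) (Icc 0 t₂) := by
    simpa using hwcont (fun _ => 1) continuous_const (by simp)
  have hFcont : ContinuousOn (fun t => F (∫ x in Ω, u x t ^ s)) (Icc 0 t₂) :=
    hF.comp_continuousOn hφcont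
  have hFint : IntervalIntegrable (fun t => F (∫ x in Ω, u x t ^ s)) volume 0 t₂ :=
    ContinuousOn.intervalIntegrable (by rw [uIcc_of_le ht₂.1.le]; exact hFcont)
  set M₂ := (μ ^ (s - 2) + M ^ (s - 2)) * M ^ 2 with hM₂
  set J := ∫ t in (0 : ℝ)..t₂, F (∫ x in Ω, u x t ^ s) with hJ
  have icu : ∀ t ∈ Icc 0 t₂, ∀ f : Euc 2 → ℝ, Continuous f → (∀ x, |f x| ≤ 1) →
      IntegrableOn (fun x => f x * u x t ^ s) Ω := fun t ht f hf hf1 => by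
    have hc1 : ContinuousOn (fun x => u x t) Ω :=
      hucont.comp (f := fun x => (x, t)) (by fun_prop) fun x hx => ⟨hx, ht⟩
    refine ho.integrableOn_of_bounded hbd (hf.continuousOn.mul
      (hc1.rpow_const fun x hx => Or.inl (hposΩ x hx t ht).ne')) (M := M ^ s) fun x hx => ?_
    have hp := Real.rpow_pos_of_pos (hposΩ x hx t ht) s
    rw [abs_mul, abs_of_pos hp]
    exact (mul_le_of_le_one_left hp.le (hf1 x)).trans
      (Real.rpow_le_rpow (hposΩ x hx t ht).le (hM x hx t ht) hs0)
  -- The order of limits matters: the admissible layer width depends on δ, so `ε` tends to zero for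
  -- fixed δ, and δ afterwards.
  have step : ∀ δ > 0, (∫ x in Ω, u x t₂ ^ s) - (∫ x in Ω, u x 0 ^ s) ≤
      J + t₂ * (s * (m * (2 * δ * volume.real Ω))) := by
    intro δ hδ
    obtain ⟨ε₀, hε₀, hlay⟩ := h.exists_layer_flux hr hΩ hl hk hg hu hsol.pos hflux ht₂.2 hδ
    have key : ∀ᶠ ε in 𝓝[>] (0 : ℝ), (∫ x in Ω, u x t₂ ^ s) - (∫ x in Ω, u x 0 ^ s) ≤
        J + t₂ * (s * (m * (2 * δ * volume.real Ω))) +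
        (t₂ * (s * (c / 4 * M₂)) + M ^ s) * ∫ x in Ω, (1 - sublevelCutoff r ε x) := by
      have h1 : ∀ᶠ ε : ℝ in 𝓝[>] 0, ε < ε₀ / 2 :=
        mem_nhdsWithin_of_mem_nhds (gt_mem_nhds (by linarith))
      filter_upwards [h1, self_mem_nhdsWithin] with ε hεlt hε
      replace hε : 0 < ε := hε
      have hqs : ContDiff ℝ ∞ (sublevelCutoff r ε) := contDiff_sublevelCutoff hr
      have hqc := hasCompactSupport_sublevelCutoff hr hΩ hbd hε
      have hqΩ := tsupport_sublevelCutoff_subset_domain hr hΩ hε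
      set η := sublevelCutoff r ε with hη
      have hη0 : ∀ x, 0 ≤ η x := sublevelCutoff_nonneg
      have hη1 : ∀ x, η x ≤ 1 := sublevelCutoff_le_one
      have hηabs : ∀ x, |η x| ≤ 1 := fun x => by rw [abs_of_nonneg (hη0 x)]; exact hη1 x
      set ι := ∫ x in Ω, (1 - η x) with hι
      set e := s * (m * (2 * δ * volume.real Ω) + c / 4 * M₂ * ι) with he
      have hder : ∀ t ∈ Ioo 0 t₂, HasDerivWithinAt (fun t => ∫ x in Ω, η x * u x t ^ s)
          (∫ x in Ω, η x * (s * u x t ^ (s - 1) * deriv (fun τ => u x τ) t)) (Ioi t) t :=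
        fun t ht => (hsol.regular.hasDerivAt_setIntegral_mul_rpow ho hbd hqs.continuous hqc hqΩ
          (fun x hx t ht => hsol.pos x (subset_closure hx) t (Ioo_subset_Ico_self ht)) s
          ⟨ht.1, ht.2.trans ht₂.2⟩).2.hasDerivWithinAt
      have hle : ∀ t ∈ Ioo 0 t₂,
          ∫ x in Ω, η x * (s * u x t ^ (s - 1) * deriv (fun τ => u x τ) t) ≤
          F (∫ x in Ω, u x t ^ s) + e := by
        intro t ht
        have ht' : t ∈ Ioo 0 T := ⟨ht.1, ht.2.trans ht₂.2⟩
        have hv := IsC21.isBoundedPositiveC1 hu hsol.regular hμ ht'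
          fun x hx => hbounds x hx t (Ioo_subset_Icc_self ht)
        have h2 := hsol.setIntegral_cutoff_deriv_le h ha hb hc hm hs
          (div_nonneg hk.le h.rho_pos.le) hr hΩ ht' hv hδ.le hε
          (fun x hx hrx => hlay x hx t (Ioo_subset_Icc_self ht) (by linarith))
        have h3 := henergy _ μ M hv
        linarith
      have hint : (∫ x in Ω, η x * u x t₂ ^ s) - (∫ x in Ω, η x * u x 0 ^ s) ≤
          ∫ t in (0 : ℝ)..t₂, (F (∫ x in Ω, u x t ^ s) + e) :=
        -- Differentiability is used only on the open interval; continuity of the weighted integral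
        -- covers the initial time, where the equation is not imposed.
        intervalIntegral.sub_le_integral_of_hasDeriv_right_of_le ht₂.1.le
        (hwcont η hqs.continuous hηabs) hder
        ((hFcont.add continuousOn_const).integrableOn_Icc) hle
      rw [intervalIntegral.integral_add hFint intervalIntegrable_const,
        intervalIntegral.integral_const, smul_eq_mul, sub_zero, ← hJ] at hint
      have iη := fun t ht => icu t ht η hqs.continuous hηabs
      have i1 : ∀ t ∈ Icc 0 t₂, IntegrableOn (fun x => u x t ^ s) Ω := fun t ht => by
        simpa using icu t ht (fun _ => 1) continuous_const (by simp)
      have i3 : IntegrableOn (fun x => 1 - η x) Ω :=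
        ho.integrableOn_of_bounded hbd (continuous_const.sub hqs.continuous).continuousOn (M := 1)
          fun x hx => by rw [abs_le]; constructor <;> linarith [hη0 x, hη1 x]
      have h0mem : (0 : ℝ) ∈ Icc 0 t₂ := left_mem_Icc.2 ht₂.1.le
      have h2mem : t₂ ∈ Icc 0 t₂ := right_mem_Icc.2 ht₂.1.le
      have b0 : ∫ x in Ω, η x * u x 0 ^ s ≤ ∫ x in Ω, u x 0 ^ s :=
        setIntegral_mono_on (iη 0 h0mem) (i1 0 h0mem) ho.measurableSet fun x hx =>
          mul_le_of_le_one_left (Real.rpow_pos_of_pos (hposΩ x hx 0 h0mem) s).le (hη1 x)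
      have b2 : ∫ x in Ω, u x t₂ ^ s ≤ (∫ x in Ω, η x * u x t₂ ^ s) + M ^ s * ι := by
        rw [hι, ← integral_const_mul, ← integral_add (iη t₂ h2mem) (i3.const_mul _)]
        refine setIntegral_mono_on (i1 t₂ h2mem) ((iη t₂ h2mem).add (i3.const_mul _))
          ho.measurableSet fun x hx => ?_
        have h3 := Real.rpow_le_rpow (hposΩ x hx t₂ h2mem).le (hM x hx t₂ h2mem) hs0
        have h4 := mul_le_mul_of_nonneg_right h3 (by linarith [hη1 x] : 0 ≤ 1 - η x)
        linarith
      have e3 : t₂ * e = t₂ * (s * (m * (2 * δ * volume.real Ω))) +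
          t₂ * (s * (c / 4 * M₂)) * ι := by rw [he]; ring
      linarith
    have hlim := ((tendsto_setIntegral_one_sub_sublevelCutoff hr hΩ hbd).const_mul
      (t₂ * (s * (c / 4 * M₂)) + M ^ s)).const_add (J + t₂ * (s * (m * (2 * δ * volume.real Ω))))
    rw [mul_zero, add_zero] at hlim
    exact ge_of_tendsto hlim key
  have hlim : Tendsto (fun δ : ℝ => J + t₂ * (s * (m * (2 * δ * volume.real Ω)))) (𝓝[>] 0)
      (𝓝 J) := by
    have hc' : Continuous fun δ : ℝ => J + t₂ * (s * (m * (2 * δ * volume.real Ω))) := by fun_prop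
    have := (hc'.tendsto 0).mono_left (nhdsWithin_le_nhds (s := Ioi (0 : ℝ)))
    simpa using this
  exact ge_of_tendsto hlim (eventually_mem_nhdsWithin.mono step)

end Solution

/-! ### Conclusion. -/

/-- Needed at the initial time, where only continuity up to the boundary is available and not
spatial differentiability of second order. -/
theorem setIntegral_rpow_pos_of_continuousOn_closure {N : ℕ} {Ω : Set (Euc N)} (hΩ : IsOpen Ω)
    (hne : Ω.Nonempty) (hc : IsCompact (closure Ω)) {f : Euc N → ℝ}
    (hf : ContinuousOn f (closure Ω)) (hpos : ∀ x ∈ closure Ω, 0 < f x) (s : ℝ) :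
    0 < ∫ x in Ω, f x ^ s := by
  have hi : IntegrableOn (fun x => f x ^ s) Ω :=
    ((hf.rpow_const fun x hx => Or.inl (hpos x hx).ne').integrableOn_compact hc).mono_set
      subset_closure
  rw [setIntegral_pos_iff_support_of_nonneg_ae
    ((ae_restrict_iff' hΩ.measurableSet).2 (ae_of_all _ fun x hx =>
      (Real.rpow_pos_of_pos (hpos x (subset_closure hx)) s).le)) hi]
  exact (hΩ.measure_pos volume hne).trans_le (measure_mono fun x hx =>
    ⟨(Real.rpow_pos_of_pos (hpos x (subset_closure hx)) s).ne', hx⟩)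

theorem IsC10.continuousOn_setIntegral_rpow {N : ℕ} {Ω : Set (Euc N)} {T : ℝ}
    {u : Euc N → ℝ → ℝ} {Du : Euc N → ℝ → Euc N} (hu : IsC10 Ω T u Du) (hΩ : IsOpen Ω)
    (hne : Ω.Nonempty) (hbd : Bornology.IsBounded Ω)
    (hpos : ∀ x ∈ closure Ω, ∀ t ∈ Ico 0 T, 0 < u x t) {s : ℝ} (hs : 0 ≤ s) :
    ContinuousOn (fun t => ∫ x in Ω, u x t ^ s) (Ico 0 T) := by
  intro t ht
  obtain ⟨t₂, h1, h2⟩ := exists_between ht.2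
  have hsub : Icc 0 t₂ ⊆ Ico 0 T := fun τ hτ => ⟨hτ.1, hτ.2.trans_lt h2⟩
  obtain ⟨μ, M, -, hb⟩ := hu.exists_bounds hbd.isCompact_closure hne hpos (ht.1.trans h1.le) h2
  have hc := continuousOn_setIntegral_mul_rpow hΩ hbd (q := fun _ => 1) continuous_const
    (by simp) (hu.cont.mono (prod_mono subset_closure hsub)) hs
    (fun x hx τ hτ => hpos x (subset_closure hx) τ (hsub hτ))
    (fun x hx τ hτ => (hb x (subset_closure hx) τ hτ).2.1)
  simp only [one_mul] at hc
  -- Bounds on the solution hold only on compact time intervals, so continuity is proved on [0, t₂]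
  -- and transferred locally.
  refine (hc t ⟨ht.1, h1.le⟩).mono_of_mem_nhdsWithin ?_
  filter_upwards [self_mem_nhdsWithin, mem_nhdsWithin_of_mem_nhds (Iio_mem_nhds h1)] with τ h3 h4
  exact ⟨h3.1, le_of_lt h4⟩

theorem theorem2 (a b c k m p q : ℝ) (ha : 0 < a) (hb : 0 < b) (hc : 0 < c) (hk : 0 < k)
    (hq : 3 / 2 < q) (hpq : q < p) (hm : 2 < m) (hmp : p < 5 → m < 8 / (5 - p))
    (vol ρ₀ d : ℝ) :
    ∃ c₁ c₅ : ℝ, 0 < c₁ ∧ 0 < c₅ ∧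
      ∀ (Ω : Set (Euc 2)) (x₀ : Euc 2), GeometricAssumption Ω x₀ ρ₀ d →
        volume.real Ω = vol →
      ∀ g : ℝ → ℝ, ContinuousOn g (Ici 0) →
        (∀ ξ : ℝ, 0 ≤ ξ → 0 ≤ g ξ ∧ g ξ ≤ k * ξ ^ (m * (p - 1) / 4 - m + 2)) →
      ∀ (u₀ : Euc 2 → ℝ) (Du₀ : Euc 2 → Euc 2) (α : ℝ≥0), 0 < α → α < 1 →
        (∀ x ∈ Ω, 0 < u₀ x) → IsC2Holder Ω α u₀ → IsC1Closure Ω u₀ Du₀ →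
        (∀ z ν : Euc 2, IsOutwardUnitNormal Ω z ν → inner ℝ (Du₀ z) ν = g (u₀ z)) →
      ∀ (u : Euc 2 → ℝ → ℝ) (tstar : ℝ), IsClassicalSolution Ω a b c m p q g u₀ tstar u →
        BlowsUpAt Ω m p u tstar →
        0 < ∫ x in Ω, u₀ x ^ (m * (p - 1)) ∧
        1 / c₁ * Real.log (1 + c₁ / c₅ * (∫ x in Ω, u₀ x ^ (m * (p - 1)))⁻¹) ≤ tstar ∧
        Ico 0 (1 / c₁ * Real.log (1 + c₁ / c₅ * (∫ x in Ω, u₀ x ^ (m * (p - 1)))⁻¹))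
          ⊆ Ico 0 tstar := by
  by_cases hρ : 0 < ρ₀
  swap
  · exact ⟨1, 1, one_pos, one_pos, fun Ω x₀ h => absurd h.rho_pos hρ⟩
  set s := m * (p - 1) with hsdef
  -- From m > 2 and p > 3/2 one gets s > 2(p - 1) > 1; the first of these inequalities also gives
  -- `hps`.
  have hs : 1 < s := by rw [hsdef]; nlinarith
  have hps : p - 1 ≤ s / 2 := by rw [hsdef]; nlinarith
  obtain ⟨c₁, c₅, h1, h5, H⟩ := exists_energy_constants (a := a) (c := c) (m := m) (κ := k / ρ₀)
    (s := s) (p := p) (ρ₀ := ρ₀) (d := d) (vol := vol) ha.le hc (by linarith)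
    (div_nonneg hk.le hρ.le) hs (by linarith) hps
  refine ⟨c₁, c₅, h1, h5, ?_⟩
  intro Ω x₀ h hvol g _ hg u₀ _ _ _ _ _ _ _ _ u T hsol hblow
  have ho := h.domain.isOpen
  have hbd := h.domain.isBounded
  have hne : Ω.Nonempty := ⟨x₀, h.mem⟩
  obtain ⟨Du, hu, -⟩ := hsol.boundary
  have e0 : ∫ x in Ω, u₀ x ^ s = ∫ x in Ω, u x 0 ^ s :=
    setIntegral_congr_fun ho.measurableSet fun x hx => by simp only [hsol.initial x hx]
  have hφpos : ∀ t ∈ Ico 0 T, 0 < ∫ x in Ω, u x t ^ s := fun t ht =>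
    setIntegral_rpow_pos_of_continuousOn_closure ho hne h.isCompact_closure
      (hu.cont.comp (f := fun x => (x, t)) (by fun_prop) fun x hx => ⟨hx, ht⟩)
      (fun x hx => hsol.pos x hx t ht) s
  have hT : 1 / c₁ * Real.log (1 + c₁ / c₅ * (∫ x in Ω, u x 0 ^ s)⁻¹) ≤ T :=
    le_blowup_time_of_integral_le h1 h5 hsol.time_pos
      (hu.continuousOn_setIntegral_rpow ho hne hbd hsol.pos (by linarith)) hφpos
      (fun t ht => hsol.setIntegral_sub_le h ha.le hb.le hc.le hk (by linarith) hs.le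
        (fun ξ hξ => (hg ξ hξ).2) (F := fun y => c₁ * y + c₅ * y ^ 2) (by fun_prop)
        (fun v μ M hv => H Ω x₀ h hvol v μ M hv) ht) hblow
  rw [e0]
  exact ⟨hφpos 0 ⟨le_rfl, hsol.time_pos⟩, hT, Ico_subset_Ico_right hT⟩
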